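/- Let $M$ be a Calabi--Yau variety of complex dimension $n$: a compact K\"ahler manifold with $H^1(M,\mathbb C)=0$ and a nowhere vanishing holomorphic volume form $\Omega$. Let $B=\Gamma(\wedge\overline T^*M\otimes\wedge TM)$, bigraded so that $\Gamma(\wedge^q\overline T^*M\otimes\wedge^pTM)$ has bidegree $(p,q)$, with differential $\bar\partial$, its graded commutative product, the operator $\Delta=\bigstar\,\partial\,\bigstar$ ($\bigstar$ denotes contraction with $\Omega$, which identifies $B$ with the complex forms, and its inverse) and the bracket $[x,y]=\Delta(xy)-(\Delta x)y-(-1)^{|x|}x\,\Delta y$. Let $H$ be the cohomology of $B$ and take the Hodge-theoretic transfer data: $\iota:H\to B$ is given by harmonic representatives, $\pi:B\to H$ by orthogonal projection to the harmonic elements, and $h=\bar\partial^*G$ with $G$ the Green operator of the $\bar\partial$-Laplacian (all with respect to the K\"ahler metric on forms, transported to $B$ by $\bigstar$). Let $\mathcal{BV}^{\text{!`}}$ be the Koszul dual cooperad of $\mathcal{BV}$, consisting of sums of trees decorated by the shifted product, bracket and $\Delta$, and let $\mathcal{H}y^{\text{!`}}$ be the quotient of its part without $\Delta$ by the image of the differential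 of $\mathcal{BV}^{\text{!`}}$. For $k\ge 2$, an element $c$ of arity $k$ of $\mathcal{BV}^{\text{!`}}$ without $\Delta$ is a sum of trivalent trees with $k$ leaves decorated by products and brackets; it defines a transferred operation $H^{\otimes k}\to H$, the sum over its trees of the composites in which leaves are decorated by $\iota$, internal edges by $h$, vertices by the product or bracket of $B$, and the root by $\pi$. Let $c$ be homogeneous with exactly $\ell$ brackets in each tree, and assume that it represents a nonzero class of $\mathcal{H}y^{\text{!`}}(k)$. (1) If the class of $c$ is a higher homotopy operation, i.e. lies in the kernel of the canonical map $\mathcal{H}y^{\text{!`}}\to\mathcal{H}y$ (projection to the cogenerators followed by their inclusion as the generators, one for each arity $k\geq 2$), then $0\le\ell<k-2$ and the transferred operation $H^{\otimes k}\to H$ has bidegree $(-\ell,-k+2)$. (2) If the class of $c$ is not in this kernel, so that $c$ represents a (nonzero multiple of the) generating $k$-ary $\mathcal{H}y$ operation of the strict truncation, then the transferred operation has bidegree $(-k+2,-k+2)$. -/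

import Mathlib

open scoped Manifold ContDiff ComplexConjugate ComplexOrder
open MeasureTheory

namespace CYHy

noncomputable section

/-- The unique element with property `P`, and `0` if there is no such unique element. -/
def theUnique {α : Type*} [Zero α] (P : α → Prop) : α :=
  open Classical in if h : ∃! a, P a then h.choose else 0

/-! ## Fibres and calculus -/

/-- The local model `ℂⁿ`. -/
abbrev Cn (n : ℕ) : Type := EuclideanSpace ℂ (Fin n)

/-- Coefficient vectors. For polyvector fields with values in antiholomorphic forms the pair
`(ω, v)` stands for `∑ ωᵢ dz̄ᵢ + ∑ vᵢ ∂/∂zᵢ`; for complex differential forms the pair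
`(ω, α)` stands for `∑ ωᵢ dz̄ᵢ + ∑ αᵢ dzᵢ`. -/
abbrev Coef (n : ℕ) : Type := (Fin n → ℂ) × (Fin n → ℂ)

/-- The fibre, in a holomorphic frame, of `⋀ T̄* ⊗ ⋀ T = ⋀ (T̄* ⊕ T)` and also of
`⋀ T̄* ⊗ ⋀ T* = ⋀ (T̄* ⊕ T*)`, with its graded commutative product. -/
abbrev Fib (n : ℕ) : Type := ExteriorAlgebra ℂ (Coef n)

/-- Linear coordinates on the finite dimensional space `Fib n`. -/
def fibCoord (n : ℕ) :
    Fib n ≃ₗ[ℂ] (Finset (Fin (Module.finrank ℂ (Coef n))) → ℂ) :=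
  (Module.finBasis ℂ (Coef n)).ExteriorAlgebra.equivFun

/-- A norm on the finite dimensional space `Fib n`; it only serves to differentiate functions
with values in `Fib n`, for which all norms are equivalent. -/
instance fibNormed (n : ℕ) : NormedAddCommGroup (Fib n) :=
  NormedAddCommGroup.induced _ _ (fibCoord n).toLinearMap (fibCoord n).injective

instance fibNormedSpace (n : ℕ) : NormedSpace ℂ (Fib n) :=
  NormedSpace.induced ℂ _ _ (fibCoord n).toLinearMap

/-- The generator `dz̄ᵢ`. -/
def dzbar {n : ℕ} (i : Fin n) : Fib n := ExteriorAlgebra.ι ℂ (Pi.single i 1, 0)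

/-- The generator `dzᵢ` (of forms), or `∂/∂zᵢ` (of polyvector fields). -/
def dz {n : ℕ} (i : Fin n) : Fib n := ExteriorAlgebra.ι ℂ (0, Pi.single i 1)

/-- The part of `Fib n` of degree `p` in the generators `∂/∂zᵢ` (or `dzᵢ`) and of degree `q` in
the generators `dz̄ᵢ`; it is zero when `p` or `q` is negative. -/
def bideg (n : ℕ) (p q : ℤ) : Submodule ℂ (Fib n) :=
  if 0 ≤ p ∧ 0 ≤ q then
    (LinearMap.range (ExteriorAlgebra.ι ℂ ∘ₗ LinearMap.inr ℂ (Fin n → ℂ) (Fin n → ℂ))) ^ p.toNat *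
    (LinearMap.range (ExteriorAlgebra.ι ℂ ∘ₗ LinearMap.inl ℂ (Fin n → ℂ) (Fin n → ℂ))) ^ q.toNat
  else ⊥

/-- `∂f/∂zᵢ` at `u`. -/
def wirt {n : ℕ} (i : Fin n) (f : Cn n → Fib n) (u : Cn n) : Fib n :=
  (1 / 2 : ℂ) • (fderiv ℝ f u (EuclideanSpace.single i 1) -
    Complex.I • fderiv ℝ f u (EuclideanSpace.single i Complex.I))

/-- `∂f/∂z̄ᵢ` at `u`. -/
def wirtBar {n : ℕ} (i : Fin n) (f : Cn n → Fib n) (u : Cn n) : Fib n :=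
  (1 / 2 : ℂ) • (fderiv ℝ f u (EuclideanSpace.single i 1) +
    Complex.I • fderiv ℝ f u (EuclideanSpace.single i Complex.I))

/-! ## Sections over a complex manifold

The tangent space at `y` is `ℂⁿ` by means of the preferred chart at `y`, so every (set-theoretic)
section of the bundles above is a function `M → Fib n`. -/

section Manifold

variable {n : ℕ} {M : Type*} [TopologicalSpace M] [ChartedSpace (Cn n) M]
  [IsManifold 𝓘(ℂ, Cn n) ω M]

/-- The holomorphic Jacobian at `y` of the change from the preferred chart at `y` to the one at
`x₀`. -/
def jac (x₀ y : M) : Matrix (Fin n) (Fin n) ℂ :=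
  Matrix.of fun i j => tangentCoordChange 𝓘(ℂ, Cn n) y x₀ y (EuclideanSpace.single j 1) i

/-- The holomorphic Jacobian at `y` of the change from the preferred chart at `x₀` to the one at
`y`. -/
def jacInv (x₀ y : M) : Matrix (Fin n) (Fin n) ℂ :=
  Matrix.of fun i j => tangentCoordChange 𝓘(ℂ, Cn n) x₀ y y (EuclideanSpace.single j 1) i

/-- Change of frame for `T̄* ⊕ T`. -/
def polyTrans (x₀ y : M) : Coef n →ₗ[ℂ] Coef n :=
  LinearMap.prodMap (Matrix.vecMulLinear ((jacInv x₀ y).map conj)) (Matrix.mulVecLin (jac x₀ y))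

/-- Change of frame for `T̄* ⊕ T*`. -/
def formTrans (x₀ y : M) : Coef n →ₗ[ℂ] Coef n :=
  LinearMap.prodMap (Matrix.vecMulLinear ((jacInv x₀ y).map conj))
    (Matrix.vecMulLinear (jacInv x₀ y))

/-- The section `s` written in the coordinates of the preferred chart at `x₀`. -/
def localRep (tr : M → M → (Coef n →ₗ[ℂ] Coef n)) (s : M → Fib n) (x₀ : M) (u : Cn n) : Fib n :=
  ExteriorAlgebra.map (tr x₀ ((extChartAt 𝓘(ℂ, Cn n) x₀).symm u))
    (s ((extChartAt 𝓘(ℂ, Cn n) x₀).symm u))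

/-- The smooth sections. -/
def smoothSections (tr : M → M → (Coef n →ₗ[ℂ] Coef n)) : Submodule ℂ (M → Fib n) where
  carrier := {s | ∀ x₀, ContDiffOn ℝ ∞ (localRep tr s x₀) (extChartAt 𝓘(ℂ, Cn n) x₀).target}
  add_mem' {s t} hs ht x₀ := by
    have h : localRep tr (s + t) x₀ = localRep tr s x₀ + localRep tr t x₀ := by
      funext u; simp [localRep]
    rw [h]
    exact (hs x₀).add (ht x₀)
  zero_mem' x₀ := by
    have h : localRep tr (0 : M → Fib n) x₀ = fun _ => 0 := by
      funext u; simp [localRep]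
    rw [h]
    exact contDiffOn_const
  smul_mem' c s hs x₀ := by
    have h : localRep tr (c • s) x₀ = c • localRep tr s x₀ := by
      funext u; simp [localRep]
    rw [h]
    exact (hs x₀).const_smul c

/-- `∂̄ s = ∑ dz̄ᵢ ∧ ∂s/∂z̄ᵢ`, computed at `x` in the preferred chart at `x`. -/
def dbarOp (tr : M → M → (Coef n →ₗ[ℂ] Coef n)) (s : M → Fib n) (x : M) : Fib n :=
  ∑ i, dzbar i * wirtBar i (localRep tr s x) (extChartAt 𝓘(ℂ, Cn n) x x)

/-- `∂ σ = ∑ dzᵢ ∧ ∂σ/∂zᵢ` for complex differential forms. -/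
def delForm (σ : M → Fib n) (x : M) : Fib n :=
  ∑ i, dz i * wirt i (localRep formTrans σ x) (extChartAt 𝓘(ℂ, Cn n) x x)

/-- The de Rham differential `d = ∂ + ∂̄` of complex differential forms. -/
def dForm (σ : M → Fib n) : M → Fib n := delForm σ + dbarOp formTrans σ

/-- The hermitian matrix field `g`, given in the preferred charts, written in the coordinates of
the preferred chart at `x₀`. -/
def localMetric (g : M → Matrix (Fin n) (Fin n) ℂ) (x₀ : M) (u : Cn n) :
    Matrix (Fin n) (Fin n) ℂ :=
  let y := (extChartAt 𝓘(ℂ, Cn n) x₀).symm u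
  (jacInv x₀ y).transpose * g y * (jacInv x₀ y).map conj

/-- The fundamental form `(i/2) ∑ g_{jk} dz_j ∧ dz̄_k`. -/
def fundamentalForm (g : M → Matrix (Fin n) (Fin n) ℂ) (x : M) : Fib n :=
  (Complex.I / 2) • ∑ j, ∑ k, g x j k • (dz j * dzbar k)

variable (n M) in
/-- The structure of a Calabi-Yau variety on the complex manifold `M` (taken compact and Hausdorff
below): a Kähler metric, a nowhere vanishing holomorphic volume form, and `H¹(M, ℂ) = 0`. -/
structure CalabiYau where
  /-- `metric x` is the matrix `g(∂/∂z_j, ∂/∂z_k)` in the preferred chart at `x`. -/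
  metric : M → Matrix (Fin n) (Fin n) ℂ
  metric_posDef : ∀ x, (metric x).PosDef
  metric_smooth : ∀ x₀ j k, ContDiffOn ℝ ∞ (fun u => localMetric metric x₀ u j k)
    (extChartAt 𝓘(ℂ, Cn n) x₀).target
  metric_kahler : dForm (fundamentalForm metric) = 0
  /-- The holomorphic volume form. -/
  vol : M → Fib n
  vol_mem : ∀ x, vol x ∈ bideg n n 0
  vol_ne_zero : ∀ x, vol x ≠ 0
  vol_holomorphic : ∀ x₀, DifferentiableOn ℂ (localRep formTrans vol x₀)
    (extChartAt 𝓘(ℂ, Cn n) x₀).target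
  /-- Every smooth closed complex `1`-form is exact. -/
  deRham_one : ∀ α ∈ smoothSections (M := M) formTrans,
    (∀ x, α x ∈ LinearMap.range (ExteriorAlgebra.ι ℂ (M := Coef n))) → dForm α = 0 →
    ∃ f : M → ℂ, (fun x => algebraMap ℂ (Fib n) (f x)) ∈ smoothSections (M := M) formTrans ∧
      dForm (fun x => algebraMap ℂ (Fib n) (f x)) = α

/-! ## Pointwise hermitian geometry of forms -/

/-- Contraction of a form with the holomorphic vector `v`. -/
def contr (v : Fin n → ℂ) : Module.End ℂ (Fib n) :=
  CliffordAlgebra.contractLeft (Q := 0)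
    ((Fintype.linearCombination ℂ v) ∘ₗ LinearMap.snd ℂ (Fin n → ℂ) (Fin n → ℂ))

/-- Contraction of a form with the conjugate of the holomorphic vector `v`. -/
def contrBar (v : Fin n → ℂ) : Module.End ℂ (Fib n) :=
  CliffordAlgebra.contractLeft (Q := 0)
    ((Fintype.linearCombination ℂ (fun i => conj (v i))) ∘ₗ
      LinearMap.fst ℂ (Fin n → ℂ) (Fin n → ℂ))

/-- A frame `f₁, …, fₙ` of the holomorphic tangent space orthonormal for the hermitian matrix
`g`. -/
def IsUnitaryFrame (g : Matrix (Fin n) (Fin n) ℂ) (f : Fin n → Fin n → ℂ) : Prop :=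
  ∀ a b, ∑ j, ∑ k, g j k * f a j * conj (f b k) = if a = b then 1 else 0

open scoped MatrixOrder in
theorem exists_unitaryFrame (g : Matrix (Fin n) (Fin n) ℂ) (hg : g.PosDef) :
    ∃ f, IsUnitaryFrame g f := by
  obtain ⟨B, hB⟩ := CStarAlgebra.nonneg_iff_eq_star_mul_self.mp hg.posSemidef.nonneg
  have hdet : IsUnit B.det := by
    have h := hg.det_pos.ne'
    rw [hB, Matrix.det_mul] at h
    exact isUnit_iff_ne_zero.mpr (right_ne_zero_of_mul h)
  rw [Matrix.star_eq_conjTranspose] at hB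
  subst hB
  refine ⟨(B⁻¹).conjTranspose, fun a b => ?_⟩
  have h : (B⁻¹).conjTranspose * (B.conjTranspose * B) * B⁻¹ = 1 := by
    rw [← Matrix.mul_assoc, ← Matrix.conjTranspose_mul, Matrix.mul_nonsing_inv _ hdet,
      Matrix.conjTranspose_one, Matrix.one_mul, Matrix.mul_nonsing_inv _ hdet]
  have h' := congrFun (congrFun h a) b
  rw [Matrix.one_apply] at h'
  rw [← h', Matrix.mul_apply, Finset.sum_comm]
  refine Finset.sum_congr rfl fun k _ => ?_
  rw [Matrix.mul_apply, Finset.sum_mul]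
  refine Finset.sum_congr rfl fun j _ => ?_
  simp only [Matrix.conjTranspose_apply, RCLike.star_def, Complex.conj_conj]
  ring

/-- The component of the form `σ` on the frame vectors `f_I` and the conjugates of `f_J`. -/
def formComp (f : Fin n → Fin n → ℂ) (I J : Finset (Fin n)) (σ : Fib n) : ℂ :=
  ExteriorAlgebra.algebraMapInv
    ((J.sort (· ≤ ·)).foldr (fun j τ => contrBar (f j) τ)
      ((I.sort (· ≤ ·)).foldr (fun i τ => contr (f i) τ) σ))

/-- `T̄* ⊕ T` acting on forms: `T̄*` by exterior multiplication on the left, `T` by contraction. -/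
def polyActionGen (n : ℕ) : Coef n →ₗ[ℂ] Module.End ℂ (Fib n) where
  toFun m := LinearMap.mulLeft ℂ (ExteriorAlgebra.ι ℂ (m.1, (0 : Fin n → ℂ))) + contr m.2
  map_add' m m' := by
    have h1 : ((m + m').1, (0 : Fin n → ℂ)) = (m.1, 0) + (m'.1, 0) := by simp
    have h2 : contr (m + m').2 = contr m.2 + contr m'.2 := by
      have : Fintype.linearCombination ℂ (m + m').2 =
          Fintype.linearCombination ℂ m.2 + Fintype.linearCombination ℂ m'.2 := by
        ext; simp [Fintype.linearCombination_apply, mul_add, Finset.sum_add_distrib]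
      simp only [contr, this, LinearMap.add_comp, map_add]
    rw [h1, h2, map_add]
    refine LinearMap.ext fun x => ?_
    simp only [LinearMap.add_apply, LinearMap.mulLeft_apply, add_mul]
    abel
  map_smul' c m := by
    have h1 : ((c • m).1, (0 : Fin n → ℂ)) = c • (m.1, 0) := by simp
    have h2 : contr (c • m).2 = c • contr m.2 := by
      have : Fintype.linearCombination ℂ (c • m).2 = c • Fintype.linearCombination ℂ m.2 := by
        ext; simp [Fintype.linearCombination_apply, Finset.mul_sum, mul_left_comm]
      simp only [contr, this, LinearMap.smul_comp, map_smul]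
    rw [h1, h2, map_smul]
    refine LinearMap.ext fun x => ?_
    simp only [LinearMap.add_apply, LinearMap.smul_apply, LinearMap.mulLeft_apply,
      smul_mul_assoc, RingHom.id_apply, smul_add]

theorem polyActionGen_sq (n : ℕ) (m : Coef n) : polyActionGen n m * polyActionGen n m = 0 := by
  refine LinearMap.ext fun x => ?_
  have h1 : contr m.2 (ExteriorAlgebra.ι ℂ (m.1, (0 : Fin n → ℂ)) * x) =
      -(ExteriorAlgebra.ι ℂ (m.1, (0 : Fin n → ℂ)) * contr m.2 x) := by
    have := CliffordAlgebra.contractLeft_ι_mul (Q := (0 : QuadraticForm ℂ (Coef n)))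
      (d := (Fintype.linearCombination ℂ m.2) ∘ₗ LinearMap.snd ℂ (Fin n → ℂ) (Fin n → ℂ))
      (m.1, (0 : Fin n → ℂ)) x
    simpa [contr, ExteriorAlgebra.ι] using this
  have h2 : contr m.2 (contr m.2 x) = 0 := CliffordAlgebra.contractLeft_contractLeft _ x
  simp only [polyActionGen, LinearMap.coe_mk, AddHom.coe_mk, Module.End.mul_apply,
    LinearMap.add_apply, LinearMap.mulLeft_apply, mul_add, h1, h2, ← mul_assoc,
    ExteriorAlgebra.ι_sq_zero, zero_mul, LinearMap.zero_apply]
  abel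

/-- The action of `⋀ (T̄* ⊕ T)` on forms. -/
def polyAction (n : ℕ) : Fib n →ₐ[ℂ] Module.End ℂ (Fib n) :=
  ExteriorAlgebra.lift ℂ ⟨polyActionGen n, polyActionGen_sq n⟩

/-! ## The complex `B` and its cohomology `H` -/

variable (n M) in
/-- `B = Γ(⋀ T̄* ⊗ ⋀ T)`, inside the algebra of all set-theoretic sections. -/
abbrev B : Submodule ℂ (M → Fib n) := smoothSections polyTrans

/-- The differential of `B`. -/
def dbar (s : M → Fib n) : M → Fib n := dbarOp polyTrans s

theorem differentiableAt_localRep {s : M → Fib n} (hs : s ∈ B n M) (x : M) :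
    DifferentiableAt ℝ (localRep polyTrans s x) (extChartAt 𝓘(ℂ, Cn n) x x) :=
  ((hs x).contDiffAt (extChartAt_target_mem_nhds x)).differentiableAt (by simp)

variable (n M) in
/-- The differential of `B` as a linear map. -/
def dbarLin : B n M →ₗ[ℂ] (M → Fib n) where
  toFun s := dbar s.1
  map_add' s t := by
    funext x
    have h : localRep polyTrans (s.1 + t.1) x =
        localRep polyTrans s.1 x + localRep polyTrans t.1 x := by
      funext u; simp [localRep]
    simp only [dbar, dbarOp, Pi.add_apply, Submodule.coe_add, h, wirtBar,
      fderiv_add (differentiableAt_localRep s.2 x) (differentiableAt_localRep t.2 x),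
      add_apply, ← Finset.sum_add_distrib]
    refine Finset.sum_congr rfl fun i _ => ?_
    rw [← mul_add, ← smul_add, smul_add Complex.I]
    congr 2
    abel
  map_smul' c s := by
    funext x
    have h : localRep polyTrans (c • s.1) x = c • localRep polyTrans s.1 x := by
      funext u; simp [localRep]
    simp only [dbar, dbarOp, Pi.smul_apply, Submodule.coe_smul, h, wirtBar, RingHom.id_apply,
      fderiv_const_smul (differentiableAt_localRep s.2 x) c, smul_apply,
      Finset.smul_sum]
    refine Finset.sum_congr rfl fun i _ => ?_
    rw [smul_comm Complex.I c, ← smul_add, smul_comm (1 / 2 : ℂ) c, mul_smul_comm]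

variable (n M) in
/-- The cocycles. -/
def cocycles : Submodule ℂ (M → Fib n) := (LinearMap.ker (dbarLin n M)).map (B n M).subtype

variable (n M) in
/-- The cohomology of `B`: cocycles modulo coboundaries. -/
abbrev H : Type _ := cocycles n M ⧸ (LinearMap.range (dbarLin n M)).submoduleOf (cocycles n M)

/-- The class of a section, and `0` if it is not a smooth cocycle. -/
def cls (s : M → Fib n) : H n M :=
  open Classical in
  if h : s ∈ cocycles n M then Submodule.Quotient.mk ⟨s, h⟩ else 0

/-- The classes in `H` of bidegree `(p, q)`: polyvector degree `p`, and degree `q` in `dz̄`. -/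
def cohBideg (p q : ℤ) : Submodule ℂ (H n M) :=
  (Submodule.comap (cocycles n M).subtype (Submodule.pi Set.univ fun _ => bideg n p q)).map
    (Submodule.mkQ _)

/-- The map `F : H^{⊗k} → H`, written as a function of `k` arguments, has bidegree `(a, b)`. -/
def HasBidegree {k : ℕ} (F : (Fin k → H n M) → H n M) (a b : ℤ) : Prop :=
  ∀ (p q : Fin k → ℤ) (x : Fin k → H n M), (∀ i, x i ∈ cohBideg (p i) (q i)) →
    F x ∈ cohBideg ((∑ i, p i) + a) ((∑ i, q i) + b)

/-! ## The Batalin-Vilkovisky structure -/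

namespace CalabiYau

variable (X : CalabiYau n M)

/-- Contraction with the holomorphic volume form, from `⋀ (T̄* ⊕ T)` to forms. -/
def bigstar (x : M) (s : Fib n) : Fib n := polyAction n s (X.vol x)

/-- The inverse of `bigstar`. -/
def bigstarInv (x : M) (σ : Fib n) : Fib n := theUnique fun s => X.bigstar x s = σ

/-- The operator `Δ = ★ ∂ ★`. -/
def bv (s : M → Fib n) (x : M) : Fib n :=
  X.bigstarInv x (delForm (fun y => X.bigstar y (s y)) x)

end CalabiYau

/-- The parity involution, `(-1)^{|s|} s` on homogeneous `s`. -/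
def par (s : M → Fib n) : M → Fib n := fun x => CliffordAlgebra.involute (s x)

namespace CalabiYau

variable (X : CalabiYau n M)

/-- The bracket `Δ(st) - (Δs)t - (-1)^{|s|} s Δt`. -/
def bracket (s t : M → Fib n) : M → Fib n :=
  X.bv (s * t) - X.bv s * t - par s * X.bv t

/-! ## Hodge theory and the transfer data

Contraction with the volume form is an isomorphism of complexes from `B` to the complex forms with
`∂̄`, so the Hodge theory of forms is expressed on `B`. On a compact manifold the elements
described below exist and are unique for smooth arguments. -/

variable [MeasurableSpace M]

/-- The Riemannian volume measure of the metric: in each chart it is `det g` times Lebesgue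
measure. These local measures agree on overlaps, and the supremum glues them. -/
def volume : Measure M :=
  ⨆ x₀ : M, Measure.map (extChartAt 𝓘(ℂ, Cn n) x₀).symm
    (((MeasureTheory.volume : Measure (Cn n)).restrict
      (extChartAt 𝓘(ℂ, Cn n) x₀).target).withDensity
        fun u => ENNReal.ofReal (localMetric X.metric x₀ u).det.re)

/-- A unitary frame at `x`. -/
def frame (x : M) : Fin n → Fin n → ℂ :=
  (exists_unitaryFrame (X.metric x) (X.metric_posDef x)).choose

/-- The hermitian inner product of forms at `x` induced by the metric. -/
def formInner (x : M) (σ τ : Fib n) : ℂ :=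
  ∑ I : Finset (Fin n), ∑ J : Finset (Fin n),
    formComp (X.frame x) I J σ * conj (formComp (X.frame x) I J τ)

/-- The global inner product of forms, transported to `B` by contraction with the volume form. -/
def inner (s t : M → Fib n) : ℂ :=
  ∫ x, X.formInner x (X.bigstar x (s x)) (X.bigstar x (t x)) ∂X.volume

/-- The formal adjoint of `∂̄`. -/
def dbarAdj (s : M → Fib n) : M → Fib n :=
  theUnique fun t => t ∈ B n M ∧ ∀ r ∈ B n M, X.inner (dbar r) s = X.inner r t

/-- The `∂̄`-Laplacian. -/
def laplacian (s : M → Fib n) : M → Fib n := dbar (X.dbarAdj s) + X.dbarAdj (dbar s)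

/-- Harmonic elements of `B`. -/
def IsHarmonic (s : M → Fib n) : Prop := s ∈ cocycles n M ∧ X.dbarAdj s = 0

/-- The orthogonal projection to the harmonic elements. -/
def harmProj (s : M → Fib n) : M → Fib n :=
  theUnique fun a => X.IsHarmonic a ∧ ∀ r, X.IsHarmonic r → X.inner a r = X.inner s r

/-- The Green operator: the inverse of the Laplacian on the orthogonal complement of the harmonic
elements, extended by zero to the harmonic elements. -/
def green (s : M → Fib n) : M → Fib n :=
  theUnique fun y => y ∈ B n M ∧ (∀ r, X.IsHarmonic r → X.inner y r = 0) ∧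
    X.laplacian y = s - X.harmProj s

/-- The inclusion `H → B` by harmonic representatives. -/
def incl (c : H n M) : M → Fib n := theUnique fun a => X.IsHarmonic a ∧ cls a = c

/-- The projection `B → H`. -/
def proj (s : M → Fib n) : H n M := cls (X.harmProj s)

/-- The homotopy `∂̄* G`. -/
def htpy (s : M → Fib n) : M → Fib n := X.dbarAdj (X.green s)

end CalabiYau

/-! ## Trees and the Koszul dual cooperads

The generators of the operad `BV` are the commutative product (degree `0`), the bracket and the
operator `Δ` (degree `-1`, both odd), where the product and the bracket are symmetric. In the cofree
cooperad on the shifted generators a product vertex is odd, whereas bracket and `Δ` vertices are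
even; the vertices of a planar tree are ordered with the root first, then the left subtree, then
the right subtree. -/

/-- Decorations of binary vertices. -/
inductive Dec : Type
  | prod
  | brk
  deriving DecidableEq

/-- Planar trees with binary vertices decorated by the product or the bracket, with unary vertices
decorated by `Δ`, and with leaves labelled by `α`. -/
inductive Tree (α : Type) : Type
  | leaf (a : α) : Tree α
  | delta (t : Tree α) : Tree α
  | node (d : Dec) (l r : Tree α) : Tree α

namespace Tree

variable {α : Type}

/-- The labels of the leaves, from left to right. -/
def leaves : Tree α → List α
  | leaf a => [a]
  | delta t => t.leaves
  | node _ l r => l.leaves ++ r.leaves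

/-- The number of vertices decorated by the product. -/
def prods : Tree α → ℕ
  | leaf _ => 0
  | delta t => t.prods
  | node d l r => (if d = Dec.prod then 1 else 0) + l.prods + r.prods

/-- The number of vertices decorated by the bracket. -/
def brks : Tree α → ℕ
  | leaf _ => 0
  | delta t => t.brks
  | node d l r => (if d = Dec.brk then 1 else 0) + l.brks + r.brks

/-- The number of vertices decorated by `Δ`. -/
def deltas : Tree α → ℕ
  | leaf _ => 0
  | delta t => t.deltas + 1
  | node _ l r => l.deltas + r.deltas

end Tree

/-- Planar trees with one leaf replaced by a hole. -/
inductive Ctx (α : Type) : Type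
  | hole : Ctx α
  | delta (K : Ctx α) : Ctx α
  | left (d : Dec) (K : Ctx α) (r : Tree α) : Ctx α
  | right (d : Dec) (l : Tree α) (K : Ctx α) : Ctx α

/-- Grafting a tree into the hole. -/
def Ctx.plug {α : Type} : Ctx α → Tree α → Tree α
  | hole, t => t
  | delta K, t => Tree.delta (K.plug t)
  | left d K r, t => Tree.node d (K.plug t) r
  | right d l K, t => Tree.node d l (K.plug t)

/-- The coefficient, in the cofree cooperad element `c`, of the tree obtained by grafting
`a (b (T₁, T₂), T₃)` into `K`. -/
def cubic {α : Type} (c : Tree α → ℂ) (K : Ctx α) (a b : Dec) (T₁ T₂ T₃ : Tree α) : ℂ :=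
  c (K.plug (.node a (.node b T₁ T₂) T₃))

/-- The sign of moving `T₁` past `T₂` and `T₃`. -/
def cycSign {α : Type} (T₁ T₂ T₃ : Tree α) : ℂ := (-1) ^ (T₁.prods * (T₂.prods + T₃.prods))

/-- An element of arity `k` of the cofree cooperad on the shifted generators is given by its
coefficients `c T` on the planar trees `T`, equivariantly under exchange of the two subtrees at a
vertex. It belongs to the Koszul dual cooperad `BV^¡` if at every pair of adjacent vertices it lies
in the space of (doubly shifted) quadratic relations of `BV`: commutativity and associativity of
the product, the Jacobi identity, the Leibniz rule, `Δ² = 0`, `Δ` is a derivation of the bracket,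
and the quadratic part `Δ(xy) - (Δx)y ∓ x(Δy)` of the definition of the bracket. -/
structure IsKoszulDual {k : ℕ} (c : Tree (Fin k) → ℂ) : Prop where
  labels : ∀ T, c T ≠ 0 → T.leaves.Perm (List.finRange k)
  swap : ∀ K d T₁ T₂, c (Ctx.plug K (.node d T₁ T₂)) =
    (-1) ^ (T₁.prods * T₂.prods) * c (Ctx.plug K (.node d T₂ T₁))
  /-- The span of `(xy)z - (yz)x` and `(yz)x - (zx)y`. -/
  assoc : ∀ K T₁ T₂ T₃, cubic c K .prod .prod T₁ T₂ T₃ +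
    cycSign T₁ T₂ T₃ * cubic c K .prod .prod T₂ T₃ T₁ +
    cycSign T₃ T₁ T₂ * cubic c K .prod .prod T₃ T₁ T₂ = 0
  /-- The span of `[[x,y],z] + [[y,z],x] + [[z,x],y]`. -/
  jacobi : ∀ K T₁ T₂ T₃, cubic c K .brk .brk T₁ T₂ T₃ =
    cycSign T₁ T₂ T₃ * cubic c K .brk .brk T₂ T₃ T₁
  /-- The span of the `[xy,z] - [y,z]x - [z,x]y`; the double shift turns the minus signs into plus
  signs. -/
  leibniz : ∀ K T₁ T₂ T₃, cubic c K .prod .brk T₁ T₂ T₃ =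
    cycSign T₁ T₂ T₃ * cubic c K .brk .prod T₂ T₃ T₁ +
    cycSign T₃ T₁ T₂ * cubic c K .brk .prod T₃ T₁ T₂
  /-- The span of `Δ(xy) - (Δx)y - x(Δy)` and of `Δ[x,y] + [Δx,y] + [x,Δy]`; the double shift
  makes all signs equal. -/
  delta_left : ∀ K d T₁ T₂, c (Ctx.plug K (.delta (.node d T₁ T₂))) =
    c (Ctx.plug K (.node d (.delta T₁) T₂))
  delta_right : ∀ K d T₁ T₂, c (Ctx.plug K (.delta (.node d T₁ T₂))) =
    c (Ctx.plug K (.node d T₁ (.delta T₂)))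

/-- The arity `k` part of `BV^¡` (of its completion with respect to the number of `Δ`, but only
homogeneous elements are used). -/
def BVco (k : ℕ) : Submodule ℂ (Tree (Fin k) → ℂ) where
  carrier := {c | IsKoszulDual c}
  zero_mem' := by constructor <;> simp [cubic]
  add_mem' {c c'} h h' :=
    { labels := fun T hT => by
        by_cases h0 : c T = 0
        · exact h'.labels T fun h1 => hT (by simp [h0, h1])
        · exact h.labels T h0
      swap := fun K d T₁ T₂ => by
        simp only [Pi.add_apply]; rw [h.swap, h'.swap]; ring
      assoc := fun K T₁ T₂ T₃ => by
        have e := h.assoc K T₁ T₂ T₃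
        have e' := h'.assoc K T₁ T₂ T₃
        simp only [cubic, Pi.add_apply] at *
        linear_combination e + e'
      jacobi := fun K T₁ T₂ T₃ => by
        have e := h.jacobi K T₁ T₂ T₃
        have e' := h'.jacobi K T₁ T₂ T₃
        simp only [cubic, Pi.add_apply] at *
        linear_combination e + e'
      leibniz := fun K T₁ T₂ T₃ => by
        have e := h.leibniz K T₁ T₂ T₃
        have e' := h'.leibniz K T₁ T₂ T₃
        simp only [cubic, Pi.add_apply] at *
        linear_combination e + e'
      delta_left := fun K d T₁ T₂ => by
        simp only [Pi.add_apply]; rw [h.delta_left, h'.delta_left]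
      delta_right := fun K d T₁ T₂ => by
        simp only [Pi.add_apply]; rw [h.delta_right, h'.delta_right] }
  smul_mem' z c h :=
    { labels := fun T hT => h.labels T fun h1 => hT (by simp [h1])
      swap := fun K d T₁ T₂ => by
        simp only [Pi.smul_apply, smul_eq_mul]; rw [h.swap]; ring
      assoc := fun K T₁ T₂ T₃ => by
        have e := h.assoc K T₁ T₂ T₃
        simp only [cubic, Pi.smul_apply, smul_eq_mul] at *
        linear_combination z * e
      jacobi := fun K T₁ T₂ T₃ => by
        have e := h.jacobi K T₁ T₂ T₃
        simp only [cubic, Pi.smul_apply, smul_eq_mul] at *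
        linear_combination z * e
      leibniz := fun K T₁ T₂ T₃ => by
        have e := h.leibniz K T₁ T₂ T₃
        simp only [cubic, Pi.smul_apply, smul_eq_mul] at *
        linear_combination z * e
      delta_left := fun K d T₁ T₂ => by
        simp only [Pi.smul_apply]; rw [h.delta_left]
      delta_right := fun K d T₁ T₂ => by
        simp only [Pi.smul_apply]; rw [h.delta_right] }

/-- The part of `BV^¡` of arity `k` in which the operator `Δ` appears `m` times. -/
def BVcoDelta (k m : ℕ) : Submodule ℂ (Tree (Fin k) → ℂ) :=
  BVco k ⊓
  { carrier := {c | ∀ T, T.deltas ≠ m → c T = 0}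
    zero_mem' := fun _ _ => rfl
    add_mem' := fun h h' T hT => by simp [h T hT, h' T hT]
    smul_mem' := fun z c h T hT => by simp [h T hT] }

/-- The differential of `BV^¡` contracts a vertex `Δ` together with a product vertex whose output
is the input of that `Δ` to one bracket vertex, in all possible ways. The coefficient of the result at a tree `T`
is therefore the signed sum, over the bracket vertices of `T`, of the coefficients at the trees in
which that vertex has been replaced by `Δ` applied to the product. -/
def diffCoeff {α : Type} : Tree α → (Tree α → ℂ) → ℂ
  | .leaf _, _ => 0
  | .delta t, c => diffCoeff t fun t' => c (.delta t')
  | .node d l r, c =>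
      (if d = Dec.brk then c (.delta (.node .prod l r)) else 0) +
      (if d = Dec.prod then -1 else 1) *
        (diffCoeff l (fun l' => c (.node d l' r)) +
          (-1) ^ l.prods * diffCoeff r (fun r' => c (.node d l r')))

theorem diffCoeff_add {α : Type} (T : Tree α) (c c' : Tree α → ℂ) :
    diffCoeff T (fun t => c t + c' t) = diffCoeff T c + diffCoeff T c' := by
  induction T generalizing c c' with
  | leaf a => simp [diffCoeff]
  | delta t ih => simp only [diffCoeff]; exact ih _ _
  | node d l r ihl ihr =>
    simp only [diffCoeff]
    rw [ihl, ihr]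
    split_ifs <;> ring

theorem diffCoeff_smul {α : Type} (T : Tree α) (z : ℂ) (c : Tree α → ℂ) :
    diffCoeff T (fun t => z * c t) = z * diffCoeff T c := by
  induction T generalizing c with
  | leaf a => simp [diffCoeff]
  | delta t ih => simp only [diffCoeff]; exact ih _
  | node d l r ihl ihr =>
    simp only [diffCoeff]
    rw [ihl, ihr]
    split_ifs <;> ring

/-- The differential of `BV^¡`. -/
def diff (k : ℕ) : (Tree (Fin k) → ℂ) →ₗ[ℂ] (Tree (Fin k) → ℂ) where
  toFun c T := diffCoeff T c
  map_add' c c' := funext fun T => diffCoeff_add T c c'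
  map_smul' z c := funext fun T => diffCoeff_smul T z c

/-- The image of the differential in the part without `Δ`. -/
def boundaries (k : ℕ) : Submodule ℂ (BVcoDelta k 0) :=
  ((BVcoDelta k 1).map (diff k)).submoduleOf (BVcoDelta k 0)

/-- The arity `k` part of the Koszul dual cooperad `Hy^¡`: the part of `BV^¡` without `Δ`, modulo
the image of the differential. -/
abbrev HyCo (k : ℕ) : Type := BVcoDelta k 0 ⧸ boundaries k

/-- The tree `[…[[i j, a₁], a₂], …]` with `a₁ < a₂ < …` the labels other than `i` and `j`. -/
def pairTree {k : ℕ} (i j : Fin k) : Tree (Fin k) :=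
  ((List.finRange k).filter fun a => a ≠ i ∧ a ≠ j).foldl
    (fun t a => .node .brk t (.leaf a)) (.node .prod (.leaf i) (.leaf j))

/-- The operad `Hy` has one generator `m_k` in each arity `k ≥ 2`. The projection of `Hy^¡` to its
cogenerators is dual to the inclusion of the generators
`{a₁, …, a_k} = ∑_{i<j} ± {aᵢ, aⱼ} a₁ ⋯ âᵢ ⋯ âⱼ ⋯ a_k` of the gravity operad, where the
Gerstenhaber operad is dual to the part of `BV^¡` without `Δ` and Koszul duality exchanges product
and bracket. This is the coefficient of (the shift of) `m_k`, on representatives. -/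
def cogen (k : ℕ) : BVcoDelta k 0 →ₗ[ℂ] ℂ :=
  (∑ i : Fin k, ∑ j ∈ Finset.Ioi i,
    (LinearMap.proj (pairTree i j) : (Tree (Fin k) → ℂ) →ₗ[ℂ] ℂ)) ∘ₗ (BVcoDelta k 0).subtype

/-- The higher homotopy operations: the kernel of `Hy^¡ → Hy`. -/
def higherOps (k : ℕ) : Submodule ℂ (HyCo k) :=
  (LinearMap.ker (cogen k)).map (boundaries k).mkQ

/-- All trees that occur in `c` have exactly `ℓ` brackets. -/
def HomogeneousBrackets {k : ℕ} (c : BVcoDelta k 0) (ℓ : ℕ) : Prop :=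
  ∀ T, c.1 T ≠ 0 → T.brks = ℓ

/-! ## The transferred operations -/

/-- The Koszul sign of rearranging homogeneous inputs of parities `ε` in the order `l`. -/
def koszulSign {k : ℕ} (ε : Fin k → Fin 2) : List (Fin k) → ℂ
  | [] => 1
  | a :: l => (l.map fun b => if b < a then (-1 : ℂ) ^ ((ε a : ℕ) * (ε b : ℕ)) else 1).prod *
      koszulSign ε l

/-- The even (`e = 0`) and odd (`e = 1`) part of a section. -/
def parityPart (e : Fin 2) (s : M → Fib n) : M → Fib n :=
  (1 / 2 : ℂ) • (s + (-1 : ℂ) ^ (e : ℕ) • par s)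

namespace CalabiYau

variable (X : CalabiYau n M) [MeasurableSpace M]

/-- The operation of `B` given by a binary vertex. -/
def binary : Dec → (M → Fib n) → (M → Fib n) → (M → Fib n)
  | .prod, s, t => s * t
  | .brk, s, t => X.bracket s t

/-- The value carried by the edge below the tree `T`, when its leaves carry `x`: internal edges are
decorated by the homotopy, leaves are not. The signs are the Koszul signs for composing the
operations `h ∘ (vertex)`, whose parity is that of the number of product vertices. -/
def edgeVal {k : ℕ} (x : Fin k → M → Fib n) : Tree (Fin k) → (M → Fib n)
  | .leaf i => x i
  | .delta t => X.htpy (X.bv (edgeVal x t))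
  | .node d l r => X.htpy ((-1 : ℂ) ^ (l.prods * r.prods) •
      X.binary d (par^[r.prods] (edgeVal x l)) (edgeVal x r))

/-- The value at the root vertex of the tree `T`, before projecting to `H`. -/
def rootVal {k : ℕ} (x : Fin k → M → Fib n) : Tree (Fin k) → (M → Fib n)
  | .leaf i => x i
  | .delta t => X.bv (X.edgeVal x t)
  | .node d l r => (-1 : ℂ) ^ (l.prods * r.prods) •
      X.binary d (par^[r.prods] (X.edgeVal x l)) (X.edgeVal x r)

/-- The operation `H^{⊗k} → H` given by the decorated tree `T`. -/
def treeOp {k : ℕ} (T : Tree (Fin k)) (x : Fin k → H n M) : H n M :=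
  ∑ ε : Fin k → Fin 2, koszulSign ε T.leaves •
    X.proj (X.rootVal (fun i => parityPart (ε i) (X.incl (x i))) T)

/-- The transferred operation `H^{⊗k} → H` of an element `c` of `BV^¡` without `Δ`: the sum of the
operations of the trees in `c`. Each tree has `2^{k-1}` planar representatives. -/
def transferredOp {k : ℕ} (c : BVcoDelta k 0) (x : Fin k → H n M) : H n M :=
  (1 / 2 : ℂ) ^ (k - 1) • ∑ᶠ T : Tree (Fin k), c.1 T • X.treeOp T x

end CalabiYau

end Manifold

end

end CYHy

namespace CYHy

noncomputable section

section

variable {α : Type}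

/-! ## Contexts and the polarization of trees -/

/-! The theorem splits into two independent statements: the bidegree of the operation of an element
with `ℓ` brackets, and the possible values of `ℓ`.

Bidegree: the torus U(1)² rescales `∂/∂z` (or `dz`) and `dz̄`, and the bidegrees are exactly the
weights of this action (`mem_weightSpace_iff`). Products and parity preserve weights, `Δ` and the
bracket lower the polyvector degree by one, the homotopy lowers the `dz̄`-degree by one, and
inclusion and projection preserve bidegrees. Operators defined as the unique solution of a problem
inherit equivariance from the problem (`theUnique_map`), so neither existence nor uniqueness of
Green operators or harmonic representatives is used. A tree with `k` leaves and `ℓ` brackets has `k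
- 1` vertices and `k - 2` internal edges, which gives bidegree `(-ℓ, -k + 2)`
(`hasBidegree_transferredOp`).

Number of brackets: if there are `p` products, then `p + ℓ = k - 1`. Hence a nonzero class in the
kernel must be shown to have `p ≥ 2`, and a class outside the kernel to have `p = 1`. Because `Δ`
can be moved to the root, the differential becomes `polar`, which turns one bracket at a time into a
product and squares to zero. The cogenerator is the polarization at a tree with brackets only, so it
vanishes on boundaries. Conversely, primitives are constructed by assigning to a tree its
`vertexForm` in an exterior algebra: functionals of vertex forms are elements of the cooperad, and
on them the differential is dual to multiplication by the sum of all `e i j` (`diff_formCoeff`). If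
that sum is a nonzero vector, contraction inverts the multiplication on the needed functionals. This
makes every element with `p = 0`, and every element with `p = 1` and zero cogenerator, a boundary.
Outside the kernel some `pairTree` has a nonzero coefficient, and it has exactly one product. -/

/-- Composition of contexts. -/
def Ctx.comp : Ctx α → Ctx α → Ctx α
  | .hole, K' => K'
  | .delta K, K' => .delta (K.comp K')
  | .left d K r, K' => .left d (K.comp K') r
  | .right d l K, K' => .right d l (K.comp K')

theorem Ctx.plug_comp (K K' : Ctx α) (T : Tree α) : (K.comp K').plug T = K.plug (K'.plug T) := by
  induction K with
  | hole => rfl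
  | delta K ih => simp [Ctx.comp, Ctx.plug, ih]
  | left d K r ih => simp [Ctx.comp, Ctx.plug, ih]
  | right d l K ih => simp [Ctx.comp, Ctx.plug, ih]

/-- The signed sum, over the bracket vertices of `T`, of the values of `c` at the trees in which
that vertex has been replaced by a product. -/
def polar : Tree α → (Tree α → ℂ) → ℂ
  | .leaf _, _ => 0
  | .delta t, c => polar t fun t' => c (.delta t')
  | .node d l r, c =>
      (if d = Dec.brk then c (.node .prod l r) else 0) +
      (if d = Dec.prod then -1 else 1) *
        (polar l (fun l' => c (.node d l' r)) +
          (-1) ^ l.prods * polar r (fun r' => c (.node d l r')))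

theorem polar_add (T : Tree α) (c c' : Tree α → ℂ) :
    polar T (fun t => c t + c' t) = polar T c + polar T c' := by
  induction T generalizing c c' with
  | leaf a => simp [polar]
  | delta t ih => simp only [polar]; exact ih _ _
  | node d l r ihl ihr =>
    simp only [polar]
    rw [ihl, ihr]
    split_ifs <;> ring

theorem polar_smul (T : Tree α) (z : ℂ) (c : Tree α → ℂ) :
    polar T (fun t => z * c t) = z * polar T c := by
  induction T generalizing c with
  | leaf a => simp [polar]
  | delta t ih => simp only [polar]; exact ih _
  | node d l r ihl ihr =>
    simp only [polar]
    rw [ihl, ihr]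
    split_ifs <;> ring

theorem polar_zero (T : Tree α) : polar T (fun _ => 0) = 0 := by
  simpa using polar_smul T 0 (fun _ => 0)

theorem polar_congr (T : Tree α) {c c' : Tree α → ℂ}
    (h : ∀ T' : Tree α, T'.leaves = T.leaves → T'.prods = T.prods + 1 → T'.deltas = T.deltas →
      c T' = c' T') : polar T c = polar T c' := by
  induction T generalizing c c' with
  | leaf a => rfl
  | delta t ih =>
    simp only [polar]
    exact ih fun T' h1 h2 h3 => h _ (by simp [Tree.leaves, h1]) (by simp [Tree.prods, h2])
      (by simp [Tree.deltas, h3])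
  | node d l r ihl ihr =>
    simp only [polar]
    rw [ihl (c' := fun l' => c' (.node d l' r)), ihr (c' := fun r' => c' (.node d l r'))]
    · by_cases hd : d = Dec.brk
      · subst hd
        rw [h (.node .prod l r) (by simp [Tree.leaves]) (by simp [Tree.prods]; ring)
          (by simp [Tree.deltas])]
      · simp [hd]
    · exact fun T' h1 h2 h3 => h _ (by simp [Tree.leaves, h1]) (by simp [Tree.prods, h2]; ring)
        (by simp [Tree.deltas, h3])
    · exact fun T' h1 h2 h3 => h _ (by simp [Tree.leaves, h1]) (by simp [Tree.prods, h2]; ring)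
        (by simp [Tree.deltas, h3])

theorem polar_comm (S T : Tree α) (c : Tree α → Tree α → ℂ) :
    polar S (fun s => polar T fun t => c s t) = polar T (fun t => polar S fun s => c s t) := by
  induction S generalizing c with
  | leaf a => simp [polar, polar_zero]
  | delta t ih => simp only [polar]; exact ih fun s t => c s.delta t
  | node d l r ihl ihr =>
    simp only [polar]
    rw [ihl fun l' t => c (.node d l' r) t, ihr fun r' t => c (.node d l r') t]
    rw [polar_add, polar_smul, polar_add, polar_smul]
    by_cases hd : d = Dec.brk
    · simp only [hd, if_true]
    · simp only [hd, if_false, polar_zero]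

/-- Product vertices are odd, so replacing two given brackets in the two possible orders gives the
same tree with opposite signs. -/
theorem polar_polar (T : Tree α) (c : Tree α → ℂ) : polar T (fun T' => polar T' c) = 0 := by
  induction T generalizing c with
  | leaf a => rfl
  | delta t ih => simp only [polar]; exact ih _
  | node d l r ihl ihr =>
    have hl : polar l (fun l' => polar (.node d l' r) c) =
        (if d = Dec.brk then polar l (fun l' => c (.node .prod l' r)) else 0) -
        (if d = Dec.prod then -1 else 1) * ((-1) ^ l.prods *
          polar l (fun l' => polar r fun r' => c (.node d l' r'))) := by
      -- A tree occurring in the polarization of `l` has one product more than `l`; this flips the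
      -- sign of the term in `r` and produces the cancellation against `hr`.
      rw [polar_congr l (c' := fun l' => (if d = Dec.brk then c (.node .prod l' r) else 0) +
        (if d = Dec.prod then -1 else 1) *
        (polar l' (fun l'' => c (.node d l'' r)) +
          (-1) ^ (l.prods + 1) * polar r (fun r' => c (.node d l' r'))))
        (fun T' _ h _ => by simp only [polar, h])]
      rw [polar_add, polar_smul, polar_add, polar_smul, ihl fun l'' => c (.node d l'' r)]
      split_ifs
      · ring
      · ring
      · rw [polar_zero]; ring
      · rw [polar_zero]; ring
    have hr : polar r (fun r' => polar (.node d l r') c) =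
        (if d = Dec.brk then polar r (fun r' => c (.node .prod l r')) else 0) +
        (if d = Dec.prod then -1 else 1) *
          polar r (fun r' => polar l fun l' => c (.node d l' r')) := by
      simp only [polar]
      rw [polar_add, polar_smul, polar_add, polar_smul, ihr fun r'' => c (.node d l r'')]
      split_ifs
      · ring
      · ring
      · rw [polar_zero]; ring
      · rw [polar_zero]; ring
    conv_lhs => unfold polar
    rw [hl, hr, polar_comm l r]
    cases d
    · simp only [reduceCtorEq, if_false, if_true]
      ring
    · simp only [reduceCtorEq, if_false, if_true]
      simp only [polar, reduceCtorEq, if_false, if_true]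
      ring

/-! ### The differential as a polarization -/

theorem diffCoeff_congr (T : Tree α) {c c' : Tree α → ℂ}
    (h : ∀ T' : Tree α, T'.leaves = T.leaves → T'.deltas = T.deltas + 1 → c T' = c' T') :
    diffCoeff T c = diffCoeff T c' := by
  induction T generalizing c c' with
  | leaf a => rfl
  | delta t ih =>
    simp only [diffCoeff]
    exact ih fun T' h1 h3 => h _ (by simp [Tree.leaves, h1]) (by simp [Tree.deltas, h3])
  | node d l r ihl ihr =>
    simp only [diffCoeff]
    rw [ihl (c' := fun l' => c' (.node d l' r)), ihr (c' := fun r' => c' (.node d l r'))]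
    · rw [h (.delta (.node .prod l r)) (by simp [Tree.leaves]) (by simp [Tree.deltas])]
    · exact fun T' h1 h3 => h _ (by simp [Tree.leaves, h1]) (by simp [Tree.deltas, h3]; ring)
    · exact fun T' h1 h3 => h _ (by simp [Tree.leaves, h1]) (by simp [Tree.deltas, h3]; ring)

theorem diffCoeff_zero (T : Tree α) : diffCoeff T (fun _ => 0) = 0 := by
  simpa using diffCoeff_smul T 0 (fun _ => 0)

/-- When `Δ` may be moved to the root, the differential is the polarization. -/
theorem diffCoeff_eq_polar (y : Tree α → ℂ)
    (hl : ∀ K d T₁ T₂, y (Ctx.plug K (.delta (.node d T₁ T₂))) =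
      y (Ctx.plug K (.node d (.delta T₁) T₂)))
    (hr : ∀ K d T₁ T₂, y (Ctx.plug K (.delta (.node d T₁ T₂))) =
      y (Ctx.plug K (.node d T₁ (.delta T₂))))
    (T : Tree α) (hT : T.deltas = 0) (K : Ctx α) :
    diffCoeff T (fun t => y (K.plug t)) = polar T (fun t => y (K.plug (.delta t))) := by
  induction T generalizing K with
  | leaf a => rfl
  | delta t ih => simp [Tree.deltas] at hT
  | node d l r ihl ihr =>
    simp only [Tree.deltas, Nat.add_eq_zero_iff] at hT
    -- Inside the enlarged context the induction hypothesis brings `Δ` to the root of the subtree;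
    -- `hl` and `hr` then bring it past the vertex `d`.
    have e1 := ihl hT.1 (K.comp (.left d .hole r))
    have e2 := ihr hT.2 (K.comp (.right d l .hole))
    simp only [Ctx.plug_comp, Ctx.plug] at e1 e2
    simp only [diffCoeff, polar, e1, e2, hl]
    simp only [← hl, ← hr]

/-! ## Vertex forms of trees -/

section Cross

variable {V : Type*} [AddCommGroup V]

/-- The sum of `f i j` over `i` in `l` and `j` in `r`. -/
def cross (f : α → α → V) (l r : List α) : V := (l.map fun i => (r.map (f i)).sum).sum

theorem cross_append_left (f : α → α → V) (l l' r : List α) :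
    cross f (l ++ l') r = cross f l r + cross f l' r := by simp [cross]

theorem cross_append_right (f : α → α → V) (l r r' : List α) :
    cross f l (r ++ r') = cross f l r + cross f l r' := by
  simp [cross, List.sum_map_add]

theorem cross_comm {f : α → α → V} (hf : ∀ i j, f i j = f j i) (l r : List α) :
    cross f l r = cross f r l := by
  induction l with
  | nil => simp [cross]
  | cons a l ih =>
    have h : cross f r (a :: l) = cross f r [a] + cross f r l := cross_append_right f r [a] l
    rw [h, ← ih]
    simp [cross, funext (hf a)]

theorem cross_perm (f : α → α → V) {l l' r r' : List α} (hl : l.Perm l') (hr : r.Perm r') :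
    cross f l r = cross f l' r' := by
  unfold cross
  rw [(hl.map _).sum_eq]
  congr 1
  exact List.map_congr_left fun i _ => (hr.map (f i)).sum_eq

variable [Module ℂ V]

theorem map_cross {W : Type*} [AddCommGroup W] [Module ℂ W] (d : V →ₗ[ℂ] W) (f : α → α → V)
    (l r : List α) : d (cross f l r) = cross (fun i j => d (f i j)) l r := by
  simp [cross, map_list_sum, List.map_map, Function.comp_def]

/-- The sum of `f i j` over the unordered pairs of entries of `l`, for `f` symmetric with zero
diagonal. -/
def pairSum (f : α → α → V) (l : List α) : V := (1 / 2 : ℂ) • cross f l l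

theorem pairSum_append {f : α → α → V} (hf : ∀ i j, f i j = f j i) (l r : List α) :
    pairSum f (l ++ r) = cross f l r + pairSum f l + pairSum f r := by
  simp only [pairSum, cross_append_left, cross_append_right, cross_comm hf r l]
  module

theorem pairSum_perm (f : α → α → V) {l l' : List α} (h : l.Perm l') :
    pairSum f l = pairSum f l' := by rw [pairSum, pairSum, cross_perm f h h]

theorem map_pairSum {W : Type*} [AddCommGroup W] [Module ℂ W] (d : V →ₗ[ℂ] W) (f : α → α → V)
    (l : List α) : d (pairSum f l) = pairSum (fun i j => d (f i j)) l := by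
  simp [pairSum, map_cross]

/-- The exterior product, over the product vertices of the tree, of the sums of `e i j` with `i`
above the left and `j` above the right input of the vertex. -/
def vertexForm (e : α → α → V) : Tree α → ExteriorAlgebra ℂ V
  | .leaf _ => 1
  | .delta t => vertexForm e t
  | .node .prod l r =>
      ExteriorAlgebra.ι ℂ (cross e l.leaves r.leaves) * vertexForm e l * vertexForm e r
  | .node .brk l r => vertexForm e l * vertexForm e r

theorem ι_mul_ι_comm (u v : V) : ExteriorAlgebra.ι ℂ u * ExteriorAlgebra.ι ℂ v =
    -(ExteriorAlgebra.ι ℂ v * ExteriorAlgebra.ι ℂ u) :=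
  eq_neg_of_add_eq_zero_left (ExteriorAlgebra.ι_add_mul_swap u v)

/-- The vertex form is a product of `T.prods` elements of degree one, so the usual sign rule of the
exterior algebra matches the tree signs. -/
theorem vertexForm_mul_ι (e : α → α → V) (T : Tree α) (v : V) :
    vertexForm e T * ExteriorAlgebra.ι ℂ v =
      (-1 : ℂ) ^ T.prods • (ExteriorAlgebra.ι ℂ v * vertexForm e T) := by
  induction T with
  | leaf a => simp [vertexForm, Tree.prods]
  | delta t ih => simpa [vertexForm, Tree.prods] using ih
  | node d l r ihl ihr =>
    cases d
    · simp only [vertexForm, Tree.prods, if_true]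
      rw [mul_assoc, ihr, mul_smul_comm, ← mul_assoc, mul_assoc _ (vertexForm e l), ihl,
        mul_smul_comm, smul_mul_assoc, ← mul_assoc, ι_mul_ι_comm _ v, smul_smul]
      simp only [neg_mul, mul_assoc, pow_add, pow_one, smul_neg, ← neg_smul]
      congr 1
      ring
    · simp only [vertexForm, Tree.prods, reduceCtorEq, if_false]
      rw [mul_assoc, ihr, mul_smul_comm, ← mul_assoc, ihl, smul_mul_assoc, smul_smul, mul_assoc]
      congr 1
      ring

theorem vertexForm_mul_comm (e : α → α → V) (S T : Tree α) :
    vertexForm e S * vertexForm e T =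
      (-1 : ℂ) ^ (S.prods * T.prods) • (vertexForm e T * vertexForm e S) := by
  induction T with
  | leaf a => simp [vertexForm, Tree.prods]
  | delta t ih => simpa [vertexForm, Tree.prods] using ih
  | node d l r ihl ihr =>
    cases d
    · simp only [vertexForm, Tree.prods, if_true]
      rw [← mul_assoc, ← mul_assoc, vertexForm_mul_ι, smul_mul_assoc, smul_mul_assoc,
        mul_assoc _ (vertexForm e S), ihl, mul_smul_comm, smul_mul_assoc, ← mul_assoc, mul_assoc,
        ihr, mul_smul_comm, smul_smul, smul_smul, ← mul_assoc]
      congr 1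
      ring
    · simp only [vertexForm, Tree.prods, reduceCtorEq, if_false]
      rw [← mul_assoc, ihl, smul_mul_assoc, mul_assoc, ihr, mul_smul_comm, smul_smul, mul_assoc]
      congr 1
      ring

/-- Replacing a bracket inserts the factor `cross e` of that vertex, and the sign in `polar` is that
of moving the factor to the front. Pairs of leaves meeting at a product vertex are not reached this
way, but their sum is already a factor of the form, so adding it changes nothing. Each pair meets at
exactly one vertex, and the total is the sum over all pairs. -/
theorem polar_vertexForm {e : α → α → V} (he : ∀ i j, e i j = e j i) (he' : ∀ i, e i i = 0)
    (φ : ExteriorAlgebra ℂ V →ₗ[ℂ] ℂ) (T : Tree α) :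
    polar T (fun t => φ (vertexForm e t)) =
      φ (ExteriorAlgebra.ι ℂ (pairSum e T.leaves) * vertexForm e T) := by
  induction T generalizing φ with
  | leaf a => simp [polar, Tree.leaves, pairSum, cross, he']
  | delta t ih => simpa [polar, vertexForm, Tree.leaves] using ih φ
  | node d l r ihl ihr =>
    have cl : ∀ {c : Tree α → ℂ} {c' : Tree α → ℂ}, (∀ T', T'.leaves = l.leaves → c T' = c' T') →
      polar l c = polar l c' := fun h => polar_congr l fun T' h1 _ _ => h T' h1
    have cr : ∀ {c : Tree α → ℂ} {c' : Tree α → ℂ}, (∀ T', T'.leaves = r.leaves → c T' = c' T') →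
      polar r c = polar r c' := fun h => polar_congr r fun T' h1 _ _ => h T' h1
    simp only [polar, Tree.leaves, pairSum_append he, map_add, add_mul]
    cases d
    · simp only [vertexForm, reduceCtorEq, if_false, if_true]
      set C := ExteriorAlgebra.ι ℂ (cross e l.leaves r.leaves) with hC
      rw [cl (c' := fun t => (φ ∘ₗ LinearMap.mulLeft ℂ C ∘ₗ
          LinearMap.mulRight ℂ (vertexForm e r)) (vertexForm e t))
          (fun T' h => by simp [h, hC, mul_assoc]),
        cr (c' := fun t => (φ ∘ₗ LinearMap.mulLeft ℂ (C * vertexForm e l)) (vertexForm e t))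
          (fun T' h => by simp [h, hC, mul_assoc]), ihl, ihr]
      simp only [LinearMap.comp_apply, LinearMap.mulLeft_apply, LinearMap.mulRight_apply]
      rw [← mul_assoc (C * vertexForm e l), mul_assoc C (vertexForm e l) (ExteriorAlgebra.ι ℂ _),
        vertexForm_mul_ι]
      simp only [mul_smul_comm, smul_mul_assoc, map_smul, smul_eq_mul]
      simp only [← mul_assoc]
      rw [hC, ExteriorAlgebra.ι_sq_zero, ι_mul_ι_comm (pairSum e l.leaves),
        ι_mul_ι_comm (pairSum e r.leaves)]
      simp only [zero_mul, map_zero, neg_mul, map_neg]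
      have := pow_mul_pow_eq_one l.prods (show (-1 : ℂ) * (-1) = 1 by norm_num)
      linear_combination (-φ (ExteriorAlgebra.ι ℂ (cross e l.leaves r.leaves) *
        ExteriorAlgebra.ι ℂ (pairSum e r.leaves) * vertexForm e l * vertexForm e r)) * this
    · simp only [vertexForm, reduceCtorEq, if_false, if_true]
      have e1 := ihl (φ ∘ₗ LinearMap.mulRight ℂ (vertexForm e r))
      have e2 := ihr (φ ∘ₗ LinearMap.mulLeft ℂ (vertexForm e l))
      simp only [LinearMap.comp_apply, LinearMap.mulLeft_apply, LinearMap.mulRight_apply] at e1 e2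
      rw [e1, e2, ← mul_assoc (vertexForm e l), vertexForm_mul_ι, smul_mul_assoc, map_smul,
        smul_eq_mul]
      simp only [← mul_assoc]
      have := pow_mul_pow_eq_one l.prods (show (-1 : ℂ) * (-1) = 1 by norm_num)
      rw [this]
      ring

end Cross

end

section

variable {α : Type}

theorem Ctx.leaves_plug_perm (K : Ctx α) {X Y : Tree α} (h : X.leaves.Perm Y.leaves) :
    (K.plug X).leaves.Perm (K.plug Y).leaves := by
  induction K with
  | hole => exact h
  | delta K ih => exact ih
  | left d K r ih => exact ih.append_right _
  | right d l K ih => exact ih.append_left _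

theorem Ctx.deltas_plug (K : Ctx α) {X Y : Tree α} (h : X.deltas = Y.deltas) :
    (K.plug X).deltas = (K.plug Y).deltas := by
  induction K with
  | hole => exact h
  | delta K ih => simp [Ctx.plug, Tree.deltas, ih]
  | left d K r ih => simp [Ctx.plug, Tree.deltas, ih]
  | right d l K ih => simp [Ctx.plug, Tree.deltas, ih]

/-! ### Cooperad elements from linear functionals of vertex forms -/

section VertexForm

variable {V : Type*} [AddCommGroup V] [Module ℂ V]

/-- The factors contributed by the context depend on the grafted tree only through its set of
leaves, so for fixed leaves grafting is linear in the vertex form. This reduces relations at a pair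
of vertices to identities in the exterior algebra. -/
theorem exists_vertexForm_plug (e : α → α → V) (K : Ctx α) (L : List α) :
    ∃ f : ExteriorAlgebra ℂ V →ₗ[ℂ] ExteriorAlgebra ℂ V,
      ∀ X : Tree α, X.leaves.Perm L → vertexForm e (K.plug X) = f (vertexForm e X) := by
  -- A tree `X₀` with these leaves is needed to write down the factors of the context; if there is
  -- none, the claim is vacuous.
  by_cases hL : ∃ X₀ : Tree α, X₀.leaves.Perm L
  swap
  · exact ⟨0, fun X hX => (hL ⟨X, hX⟩).elim⟩
  obtain ⟨X₀, h₀⟩ := hL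
  induction K with
  | hole => exact ⟨LinearMap.id, fun X _ => rfl⟩
  | delta K ih => exact ih
  | left d K r ih =>
    obtain ⟨f, hf⟩ := ih
    cases d
    · refine ⟨LinearMap.mulLeft ℂ (ExteriorAlgebra.ι ℂ (cross e (K.plug X₀).leaves r.leaves)) ∘ₗ
        LinearMap.mulRight ℂ (vertexForm e r) ∘ₗ f, fun X hX => ?_⟩
      simp [Ctx.plug, vertexForm, hf X hX, mul_assoc,
        cross_perm e (K.leaves_plug_perm (hX.trans h₀.symm)) (List.Perm.refl r.leaves)]
    · exact ⟨LinearMap.mulRight ℂ (vertexForm e r) ∘ₗ f, fun X hX => by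
        simp [Ctx.plug, vertexForm, hf X hX]⟩
  | right d l K ih =>
    obtain ⟨f, hf⟩ := ih
    cases d
    · refine ⟨LinearMap.mulLeft ℂ (ExteriorAlgebra.ι ℂ (cross e l.leaves (K.plug X₀).leaves) *
        vertexForm e l) ∘ₗ f, fun X hX => ?_⟩
      simp [Ctx.plug, vertexForm, hf X hX, mul_assoc,
        cross_perm e (List.Perm.refl l.leaves) (K.leaves_plug_perm (hX.trans h₀.symm))]
    · exact ⟨LinearMap.mulLeft ℂ (vertexForm e l) ∘ₗ f, fun X hX => by
        simp [Ctx.plug, vertexForm, hf X hX]⟩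

/-- The coefficients given by a linear functional of the vertex form, on the trees with `m`
vertices `Δ`. -/
def formCoeff {k : ℕ} (e : Fin k → Fin k → V) (φ : ExteriorAlgebra ℂ V →ₗ[ℂ] ℂ) (m : ℕ)
    (T : Tree (Fin k)) : ℂ :=
  open Classical in
  if T.leaves.Perm (List.finRange k) ∧ T.deltas = m then φ (vertexForm e T) else 0

variable {k : ℕ} {e : Fin k → Fin k → V} {φ : ExteriorAlgebra ℂ V →ₗ[ℂ] ℂ} {m : ℕ}

theorem formCoeff_of_pos {T : Tree (Fin k)} (h : T.leaves.Perm (List.finRange k))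
    (hm : T.deltas = m) : formCoeff e φ m T = φ (vertexForm e T) := if_pos ⟨h, hm⟩

/-- For trees with the same labels and number of `Δ`, the coefficients in a context are given by
one linear functional of the vertex form. -/
theorem exists_formCoeff_plug (e : Fin k → Fin k → V) (φ : ExteriorAlgebra ℂ V →ₗ[ℂ] ℂ) (m : ℕ)
    (K : Ctx (Fin k)) (X₀ : Tree (Fin k)) :
    ∃ ψ : ExteriorAlgebra ℂ V →ₗ[ℂ] ℂ, ∀ X : Tree (Fin k), X.leaves.Perm X₀.leaves →
      X.deltas = X₀.deltas → formCoeff e φ m (K.plug X) = ψ (vertexForm e X) := by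
  classical
  obtain ⟨f, hf⟩ := exists_vertexForm_plug e K X₀.leaves
  by_cases h : (K.plug X₀).leaves.Perm (List.finRange k) ∧ (K.plug X₀).deltas = m
  · refine ⟨φ ∘ₗ f, fun X h1 h2 => ?_⟩
    rw [formCoeff_of_pos ((K.leaves_plug_perm h1).trans h.1) ((K.deltas_plug h2).trans h.2),
      hf X h1, LinearMap.comp_apply]
  · refine ⟨0, fun X h1 h2 => if_neg fun h' => h ⟨?_, ?_⟩⟩
    · exact (K.leaves_plug_perm h1).symm.trans h'.1
    · exact (K.deltas_plug h2).symm.trans h'.2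

theorem perm_rotate (a b c : List α) : ((b ++ c) ++ a).Perm ((a ++ b) ++ c) := by
  rw [List.append_assoc a]
  exact List.perm_append_comm

theorem vertexForm_rotate (e : α → α → V) (T₁ T₂ T₃ : Tree α) :
    vertexForm e T₁ * vertexForm e T₂ * vertexForm e T₃ =
      cycSign T₁ T₂ T₃ • (vertexForm e T₂ * vertexForm e T₃ * vertexForm e T₁) := by
  have h := vertexForm_mul_comm e T₁ (.node .brk T₂ T₃)
  simp only [vertexForm, Tree.prods, reduceCtorEq, if_false, zero_add] at h
  rw [mul_assoc, h, cycSign]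

theorem cycSign_sq (T₁ T₂ T₃ : Tree α) : cycSign T₁ T₂ T₃ * cycSign T₁ T₂ T₃ = 1 :=
  pow_mul_pow_eq_one _ (by norm_num)

/-- Each relation becomes an identity of vertex forms. Brackets merely multiply forms, which is
graded commutative and associative; the Leibniz relation is additivity of `cross` in the leaves;
associativity of the product follows from anticommutativity of the three vectors attached to the
pairs of subtrees. Vertices `Δ` do not affect the form. -/
theorem isKoszulDual_formCoeff (he : ∀ i j, e i j = e j i) (φ : ExteriorAlgebra ℂ V →ₗ[ℂ] ℂ)
    (m : ℕ) : IsKoszulDual (formCoeff e φ m) where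
  labels T hT := by
    by_contra h
    exact hT (if_neg fun h' => h h'.1)
  swap K d T₁ T₂ := by
    obtain ⟨ψ, hψ⟩ := exists_formCoeff_plug e φ m K (.node d T₁ T₂)
    rw [hψ _ (List.Perm.refl _) rfl, hψ (.node d T₂ T₁) List.perm_append_comm (add_comm _ _),
      ← smul_eq_mul, ← map_smul]
    congr 1
    cases d
    · simp only [vertexForm]
      rw [mul_assoc, vertexForm_mul_comm, mul_smul_comm, cross_comm he, mul_assoc]
    · exact vertexForm_mul_comm e T₁ T₂
  assoc K T₁ T₂ T₃ := by
    obtain ⟨ψ, hψ⟩ := exists_formCoeff_plug e φ m K (.node .prod (.node .prod T₁ T₂) T₃)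
    simp only [cubic]
    rw [hψ _ (List.Perm.refl _) rfl,
      hψ (.node .prod (.node .prod T₂ T₃) T₁) (perm_rotate _ _ _) (by simp [Tree.deltas]; ring),
      hψ (.node .prod (.node .prod T₃ T₁) T₂) (perm_rotate _ _ _).symm
        (by simp [Tree.deltas]; ring),
      ← smul_eq_mul, ← smul_eq_mul, ← map_smul, ← map_smul, ← map_add, ← map_add]
    convert map_zero ψ
    simp only [vertexForm, Tree.leaves, cross_append_left, map_add]
    set a := ExteriorAlgebra.ι ℂ (cross e T₁.leaves T₂.leaves) with ha
    set b := ExteriorAlgebra.ι ℂ (cross e T₂.leaves T₃.leaves) with hb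
    set c := ExteriorAlgebra.ι ℂ (cross e T₃.leaves T₁.leaves) with hc
    rw [cross_comm he T₁.leaves T₃.leaves, cross_comm he T₂.leaves T₁.leaves,
      cross_comm he T₃.leaves T₂.leaves, ← ha, ← hb, ← hc]
    have r1 := vertexForm_rotate e T₁ T₂ T₃
    have r3 := vertexForm_rotate e T₃ T₁ T₂
    set P := vertexForm e T₁ * vertexForm e T₂ * vertexForm e T₃ with hP
    have e2 : cycSign T₁ T₂ T₃ • ((a + c) * (b * vertexForm e T₂ * vertexForm e T₃) *
        vertexForm e T₁) = (a + c) * b * P := by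
      rw [r1, mul_smul_comm]; simp only [mul_assoc]
    have e3 : cycSign T₃ T₁ T₂ • ((b + a) * (c * vertexForm e T₃ * vertexForm e T₁) *
        vertexForm e T₂) = (b + a) * c * P := by
      have : (b + a) * (c * vertexForm e T₃ * vertexForm e T₁) * vertexForm e T₂ =
        (b + a) * c * (vertexForm e T₃ * vertexForm e T₁ * vertexForm e T₂) := by
        simp only [mul_assoc]
      rw [this, r3, mul_smul_comm, smul_smul, cycSign_sq, one_smul]
    have e1 : (c + b) * (a * vertexForm e T₁ * vertexForm e T₂) * vertexForm e T₃ =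
        (c + b) * a * P := by simp only [hP, mul_assoc]
    rw [e1, e2, e3, ← add_mul, ← add_mul]
    -- What remains is `(c + b)a + (a + c)b + (b + a)c = 0`, in which the six terms cancel in pairs.
    have hab : a * b = -(b * a) := ι_mul_ι_comm _ _
    have hac : a * c = -(c * a) := ι_mul_ι_comm _ _
    have hbc : b * c = -(c * b) := ι_mul_ι_comm _ _
    convert zero_mul P
    simp only [add_mul, hab, hac, hbc]
    abel
  jacobi K T₁ T₂ T₃ := by
    obtain ⟨ψ, hψ⟩ := exists_formCoeff_plug e φ m K (.node .brk (.node .brk T₁ T₂) T₃)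
    simp only [cubic]
    rw [hψ _ (List.Perm.refl _) rfl,
      hψ (.node .brk (.node .brk T₂ T₃) T₁) (perm_rotate _ _ _) (by simp [Tree.deltas]; ring),
      ← smul_eq_mul, ← map_smul]
    congr 1
    exact vertexForm_rotate e T₁ T₂ T₃
  leibniz K T₁ T₂ T₃ := by
    obtain ⟨ψ, hψ⟩ := exists_formCoeff_plug e φ m K (.node .prod (.node .brk T₁ T₂) T₃)
    simp only [cubic]
    rw [hψ _ (List.Perm.refl _) rfl,
      hψ (.node .brk (.node .prod T₂ T₃) T₁) (perm_rotate _ _ _) (by simp [Tree.deltas]; ring),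
      hψ (.node .brk (.node .prod T₃ T₁) T₂) (perm_rotate _ _ _).symm
        (by simp [Tree.deltas]; ring),
      ← smul_eq_mul, ← smul_eq_mul, ← map_smul, ← map_smul, ← map_add]
    congr 1
    simp only [vertexForm, Tree.leaves, cross_append_left, map_add]
    have r1 := vertexForm_rotate e T₁ T₂ T₃
    have r3 := vertexForm_rotate e T₃ T₁ T₂
    rw [cross_comm he T₁.leaves T₃.leaves]
    simp only [mul_assoc] at r1 r3 ⊢
    rw [r3]
    simp only [mul_smul_comm, smul_smul, cycSign_sq, one_smul]
    rw [← mul_smul_comm, ← r1]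
    simp only [add_mul]
    abel
  delta_left K d T₁ T₂ := by
    obtain ⟨ψ, hψ⟩ := exists_formCoeff_plug e φ m K (.delta (.node d T₁ T₂))
    rw [hψ _ (List.Perm.refl _) rfl,
      hψ (.node d (.delta T₁) T₂) (List.Perm.refl _) (by simp [Tree.deltas]; ring)]
    cases d <;> rfl
  delta_right K d T₁ T₂ := by
    obtain ⟨ψ, hψ⟩ := exists_formCoeff_plug e φ m K (.delta (.node d T₁ T₂))
    rw [hψ _ (List.Perm.refl _) rfl,
      hψ (.node d T₁ (.delta T₂)) (List.Perm.refl _) (by simp [Tree.deltas]; ring)]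
    cases d <;> rfl

theorem formCoeff_mem (he : ∀ i j, e i j = e j i) (φ : ExteriorAlgebra ℂ V →ₗ[ℂ] ℂ)
    (m : ℕ) : formCoeff e φ m ∈ BVcoDelta k m :=
  ⟨isKoszulDual_formCoeff he φ m, fun _ hT => if_neg fun h => hT h.2⟩

/-- The differential of the elements given by vertex forms is the multiplication by the sum of all
`e i j`. -/
theorem diff_formCoeff (he : ∀ i j, e i j = e j i) (he' : ∀ i, e i i = 0)
    (φ : ExteriorAlgebra ℂ V →ₗ[ℂ] ℂ) :
    diff k (formCoeff e φ 1) = formCoeff e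
      (φ ∘ₗ LinearMap.mulLeft ℂ (ExteriorAlgebra.ι ℂ (pairSum e (List.finRange k)))) 0 := by
  classical
  funext T
  change diffCoeff T (formCoeff e φ 1) = _
  by_cases h : T.leaves.Perm (List.finRange k) ∧ T.deltas = 0
  · have hc := isKoszulDual_formCoeff he φ 1
    rw [formCoeff_of_pos h.1 h.2]
    refine (diffCoeff_eq_polar _ hc.delta_left hc.delta_right T h.2 .hole).trans ?_
    rw [polar_congr T (c' := fun t => φ (vertexForm e t)), polar_vertexForm he he',
      pairSum_perm e h.1]
    · rfl
    · intro T' h1 _ h3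
      exact formCoeff_of_pos (by simpa [Ctx.plug, Tree.leaves, h1] using h.1)
        (by simp [Ctx.plug, Tree.deltas, h3, h.2])
  · have h0 : formCoeff e (φ ∘ₗ LinearMap.mulLeft ℂ
        (ExteriorAlgebra.ι ℂ (pairSum e (List.finRange k)))) 0 T = 0 := if_neg h
    rw [h0, ← diffCoeff_zero T]
    refine diffCoeff_congr T fun T' h1 h3 => if_neg fun h' => h ?_
    rw [h1, h3] at h'
    exact ⟨h'.1, by omega⟩

end VertexForm

/-! ## Elements with one product -/

/-- Two trees have the same coefficients in all contexts. -/
def ContextEq (c : Tree α → ℂ) (T T' : Tree α) : Prop := ∀ K : Ctx α, c (K.plug T) = c (K.plug T')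

theorem ContextEq.refl (c : Tree α → ℂ) (T : Tree α) : ContextEq c T T := fun _ => rfl

theorem ContextEq.trans {c : Tree α → ℂ} {T T' T'' : Tree α} (h : ContextEq c T T')
    (h' : ContextEq c T' T'') : ContextEq c T T'' := fun K => (h K).trans (h' K)

theorem ContextEq.symm {c : Tree α → ℂ} {T T' : Tree α} (h : ContextEq c T T') :
    ContextEq c T' T := fun K => (h K).symm

theorem ContextEq.left {c : Tree α → ℂ} {T T' : Tree α} (h : ContextEq c T T') (d : Dec)
    (r : Tree α) : ContextEq c (.node d T r) (.node d T' r) := fun K => by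
  simpa [Ctx.plug_comp, Ctx.plug] using h (K.comp (.left d .hole r))

theorem ContextEq.right {c : Tree α → ℂ} {T T' : Tree α} (h : ContextEq c T T') (d : Dec)
    (l : Tree α) : ContextEq c (.node d l T) (.node d l T') := fun K => by
  simpa [Ctx.plug_comp, Ctx.plug] using h (K.comp (.right d l .hole))

/-- The tree `[…[[X, a₁], a₂], …]`. -/
def comb (X : Tree α) (l : List α) : Tree α := l.foldl (fun t a => .node .brk t (.leaf a)) X

@[simp] theorem comb_nil (X : Tree α) : comb X [] = X := rfl

@[simp] theorem comb_cons (X : Tree α) (a : α) (l : List α) :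
    comb X (a :: l) = comb (.node .brk X (.leaf a)) l := rfl

theorem comb_append (X : Tree α) (l l' : List α) : comb X (l ++ l') = comb (comb X l) l' :=
  List.foldl_append

@[simp] theorem prods_comb (X : Tree α) (l : List α) : (comb X l).prods = X.prods := by
  induction l generalizing X with
  | nil => rfl
  | cons a l ih => simp [ih, Tree.prods]

@[simp] theorem deltas_comb (X : Tree α) (l : List α) : (comb X l).deltas = X.deltas := by
  induction l generalizing X with
  | nil => rfl
  | cons a l ih => simp [ih, Tree.deltas]

@[simp] theorem leaves_comb (X : Tree α) (l : List α) : (comb X l).leaves = X.leaves ++ l := by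
  induction l generalizing X with
  | nil => simp
  | cons a l ih => simp [ih, Tree.leaves]

theorem ContextEq.comb {c : Tree α → ℂ} {T T' : Tree α} (h : ContextEq c T T') (l : List α) :
    ContextEq c (comb T l) (comb T' l) := by
  induction l generalizing T T' with
  | nil => exact h
  | cons a l ih => exact ih (h.left _ _)

/-! ### Normal forms of trees with at most one product -/

namespace IsKoszulDual

variable {k : ℕ} {c : Tree (Fin k) → ℂ}

theorem node_comm (hc : IsKoszulDual c) (d : Dec) {T₁ T₂ : Tree (Fin k)}
    (h : T₁.prods * T₂.prods = 0) :
    ContextEq c (.node d T₁ T₂) (.node d T₂ T₁) := fun K => by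
  rw [hc.swap, h, pow_zero, one_mul]

/-- On coefficients, cyclic invariance together with the swap relation says that the bracket is
commutative and associative. With at most one product among the three subtrees all signs are `1`. -/
theorem brk_assoc (hc : IsKoszulDual c) {T₁ T₂ T₃ : Tree (Fin k)}
    (h : T₁.prods + T₂.prods + T₃.prods ≤ 1) :
    ContextEq c (.node .brk (.node .brk T₁ T₂) T₃) (.node .brk T₁ (.node .brk T₂ T₃)) := by
  have h1 : T₁.prods * (T₂.prods + T₃.prods) = 0 := by
    rcases Nat.eq_zero_or_pos T₁.prods with h0 | h0
    · simp [h0]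
    · have : T₂.prods + T₃.prods = 0 := by omega
      simp [this]
  refine ContextEq.trans (fun K => ?_) (hc.node_comm .brk (T₁ := .node .brk T₂ T₃) (T₂ := T₁) ?_)
  · have := hc.jacobi K T₁ T₂ T₃
    rwa [cycSign, h1, pow_zero, one_mul] at this
  · simpa [Tree.prods, mul_comm] using h1

theorem brk_eq_comb (hc : IsKoszulDual c) {t r : Tree (Fin k)} (ht : t.prods ≤ 1) (hr : r.prods = 0)
    (hr' : r.deltas = 0) : ContextEq c (.node .brk t r) (comb t r.leaves) := by
  induction r generalizing t with
  | leaf a => exact ContextEq.refl _ _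
  | delta r ih => simp [Tree.deltas] at hr'
  | node d r₁ r₂ ih₁ ih₂ =>
    cases d
    · simp [Tree.prods] at hr
    · simp only [Tree.prods, reduceCtorEq, if_false, zero_add, Nat.add_eq_zero_iff] at hr
      simp only [Tree.deltas, Nat.add_eq_zero_iff] at hr'
      refine (hc.brk_assoc (by omega)).symm.trans ?_
      refine ((ih₁ ht hr.1 hr'.1).left .brk r₂).trans ?_
      rw [Tree.leaves, comb_append]
      exact ih₂ (by simpa using ht) hr.2 hr'.2

/-- Adjacent entries can be exchanged by reassociating, commuting the two leaves and reassociating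
back. -/
theorem comb_perm (hc : IsKoszulDual c) {X : Tree (Fin k)} (hX : X.prods ≤ 1)
    {l l' : List (Fin k)} (h : l.Perm l') :
    ContextEq c (comb X l) (comb X l') := by
  induction h generalizing X with
  | nil => exact ContextEq.refl _ _
  | cons a _ ih => exact ih (by simpa [Tree.prods] using hX)
  | swap a b l =>
    refine ContextEq.comb ?_ l
    refine (hc.brk_assoc (by simpa [Tree.prods] using hX)).trans ?_
    refine ContextEq.trans ?_ (hc.brk_assoc (by simpa [Tree.prods] using hX)).symm
    exact (hc.node_comm _ (by simp [Tree.prods])).right _ _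
  | trans _ _ ih₁ ih₂ => exact (ih₁ hX).trans (ih₂ hX)

/-- By commutativity and associativity any chosen leaf can be made the innermost one; fixing the
same leaf for two trees makes their combs comparable. -/
theorem eq_comb_leaf (hc : IsKoszulDual c) {T : Tree (Fin k)} (hT : T.prods = 0)
    (hT' : T.deltas = 0) {a : Fin k} (ha : a ∈ T.leaves) :
    ∃ l, T.leaves.Perm (a :: l) ∧ ContextEq c T (comb (.leaf a) l) := by
  induction T with
  | leaf b =>
    simp only [Tree.leaves, List.mem_singleton] at ha
    subst ha
    exact ⟨[], List.Perm.refl _, ContextEq.refl _ _⟩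
  | delta r ih => simp [Tree.deltas] at hT'
  | node d l r ihl ihr =>
    cases d
    · simp [Tree.prods] at hT
    simp only [Tree.prods, reduceCtorEq, if_false, zero_add, Nat.add_eq_zero_iff] at hT
    simp only [Tree.deltas, Nat.add_eq_zero_iff] at hT'
    rw [Tree.leaves, List.mem_append] at ha
    rcases ha with ha | ha
    · obtain ⟨l', h1, h2⟩ := ihl hT.1 hT'.1 ha
      refine ⟨l' ++ r.leaves, h1.append_right _, (h2.left _ _).trans ?_⟩
      rw [comb_append]
      exact hc.brk_eq_comb (by simp [Tree.prods]) hT.2 hT'.2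
    · obtain ⟨l', h1, h2⟩ := ihr hT.2 hT'.2 ha
      refine ⟨l' ++ l.leaves, List.perm_append_comm.trans (h1.append_right _),
        (hc.node_comm _ (by simp [hT.1])).trans ((h2.left _ _).trans ?_)⟩
      rw [comb_append]
      exact hc.brk_eq_comb (by simp [Tree.prods]) hT.1 hT'.1

/-- All trees with brackets only have the same coefficient. -/
theorem apply_eq_of_prods_eq_zero (hc : IsKoszulDual c) (hk : 0 < k) {T T' : Tree (Fin k)}
    (hT : T.prods = 0) (hT' : T'.prods = 0) (h : T.deltas = 0) (h' : T'.deltas = 0)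
    (hp : T.leaves.Perm (List.finRange k)) (hp' : T'.leaves.Perm (List.finRange k)) :
    c T = c T' := by
  obtain ⟨l, h1, h2⟩ := hc.eq_comb_leaf hT h (a := ⟨0, hk⟩) (hp.mem_iff.2 (List.mem_finRange _))
  obtain ⟨l', h1', h2'⟩ :=
    hc.eq_comb_leaf hT' h' (a := ⟨0, hk⟩) (hp'.mem_iff.2 (List.mem_finRange _))
  have hl : l.Perm l' := (List.perm_cons _).1 (h1.symm.trans ((hp.trans hp'.symm).trans h1'))
  exact (h2.trans ((hc.comb_perm (by simp [Tree.prods]) hl).trans h2'.symm)) .hole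

end IsKoszulDual

/-- The sum of `w i j` over the product vertices and the pairs of leaves that meet there. -/
def prodSum (w : α → α → ℂ) : Tree α → ℂ
  | .leaf _ => 0
  | .delta t => prodSum w t
  | .node d l r => (if d = Dec.prod then cross w l.leaves r.leaves else 0) +
      prodSum w l + prodSum w r

theorem prodSum_eq_zero (w : α → α → ℂ) {T : Tree α} (h : T.prods = 0) : prodSum w T = 0 := by
  induction T with
  | leaf a => rfl
  | delta t ih => exact ih h
  | node d l r ihl ihr =>
    cases d
    · simp [Tree.prods] at h
    · simp only [Tree.prods, reduceCtorEq, if_false, zero_add, Nat.add_eq_zero_iff] at h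
      simp [prodSum, ihl h.1, ihr h.2]

/-- Every pair of leaves meets at exactly one vertex, and each vertex becomes the product exactly
once. -/
theorem polar_prodSum {w : α → α → ℂ} (hw : ∀ i j, w i j = w j i) (hw' : ∀ i, w i i = 0)
    {T : Tree α} (h : T.prods = 0) : polar T (prodSum w) = pairSum w T.leaves := by
  induction T with
  | leaf a => simp [polar, Tree.leaves, pairSum, cross, hw']
  | delta t ih => exact ih h
  | node d l r ihl ihr =>
    cases d
    · simp [Tree.prods] at h
    · simp only [Tree.prods, reduceCtorEq, if_false, zero_add, Nat.add_eq_zero_iff] at h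
      simp only [polar, prodSum, prodSum_eq_zero w h.1, prodSum_eq_zero w h.2, reduceCtorEq,
        if_true, if_false, zero_add, add_zero, h.1, pow_zero, one_mul]
      rw [ihl h.1, ihr h.2, Tree.leaves, pairSum_append hw]
      ring

/-- The Leibniz relation pulls brackets out of the inputs of the unique product until both inputs
are leaves, and the surrounding brackets straighten into a comb. Hence the coefficients at combs
determine all others. The induction is on a bound for the number of leaves of the subtree that
contains the product, with the context free to grow. -/
theorem IsKoszulDual.plug_eq_prodSum {k : ℕ} {c : Tree (Fin k) → ℂ} (hc : IsKoszulDual c)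
    {w : Fin k → Fin k → ℂ} (hw : ∀ i j, w i j = w j i) (N : ℕ) (T : Tree (Fin k))
    (hN : T.leaves.length ≤ N) (hT : T.prods = 1) (hT' : T.deltas = 0) (K : Ctx (Fin k))
    (h : ∀ i j l, (i :: j :: l).Perm T.leaves →
      c (K.plug (comb (.node .prod (.leaf i) (.leaf j)) l)) = w i j) :
    c (K.plug T) = prodSum w T := by
  -- Every subtree has a leaf, so passing to an input of a vertex strictly lowers the number of
  -- leaves.
  have hpos : ∀ T : Tree (Fin k), 0 < T.leaves.length := by
    intro T
    induction T with
    | leaf a => simp [Tree.leaves]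
    | delta t ih => exact ih
    | node d l r ihl _ => simp [Tree.leaves]; omega
  induction N generalizing T K with
  | zero => exact absurd hN (by have := hpos T; omega)
  | succ N ih =>
    -- a bracket whose left input contains the product
    have key : ∀ (l r : Tree (Fin k)) (K : Ctx (Fin k)),
        l.leaves.length + r.leaves.length ≤ N + 1 → l.prods = 1 → l.deltas = 0 → r.prods = 0 →
        r.deltas = 0 → (∀ i j l', (i :: j :: l').Perm (l.leaves ++ r.leaves) →
          c (K.plug (comb (.node .prod (.leaf i) (.leaf j)) l')) = w i j) →
        c (K.plug (.node .brk l r)) = prodSum w l := by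
      intro l r K hN hl hl' hr hr' h
      have e := ih l (by have := hpos r; omega) hl hl' (K.comp (.left .brk .hole r))
      simp only [Ctx.plug_comp, Ctx.plug] at e
      refine e fun i j l' hp => ?_
      -- The bracket with `r` lengthens the comb by the leaves of `r`, so the hypothesis in the
      -- larger context is an instance of the given one.
      rw [hc.brk_eq_comb (by simp [Tree.prods]) hr hr' K, ← comb_append]
      exact h i j _ (hp.append_right r.leaves)
    -- a product whose left input is a bracket
    have key' : ∀ (l₁ l₂ r : Tree (Fin k)) (K : Ctx (Fin k)),
        l₁.leaves.length + l₂.leaves.length + r.leaves.length ≤ N + 1 → l₁.prods = 0 →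
        l₂.prods = 0 → l₁.deltas = 0 → l₂.deltas = 0 → r.prods = 0 → r.deltas = 0 →
        (∀ i j l', (i :: j :: l').Perm ((l₁.leaves ++ l₂.leaves) ++ r.leaves) →
          c (K.plug (comb (.node .prod (.leaf i) (.leaf j)) l')) = w i j) →
        c (K.plug (.node .prod (.node .brk l₁ l₂) r)) =
          cross w (l₁.leaves ++ l₂.leaves) r.leaves := by
      intro l₁ l₂ r K hN h1 h2 h1' h2' hr hr' h
      have e := hc.leibniz K l₁ l₂ r
      simp only [cubic, cycSign, h1, hr, zero_mul, pow_zero, one_mul] at e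
      rw [e, key (.node .prod l₂ r) l₁ K, key (.node .prod r l₁) l₂ K]
      · simp only [prodSum, if_true, prodSum_eq_zero w h1, prodSum_eq_zero w h2,
          prodSum_eq_zero w hr, cross_append_left, cross_comm hw r.leaves]
        ring
      · simp [Tree.leaves]; omega
      · simp [Tree.prods, h1, hr]
      · simp [Tree.deltas, h1', hr']
      · exact h2
      · exact h2'
      · exact fun i j l' hp => h i j l' (hp.trans (perm_rotate _ _ _).symm)
      · simp [Tree.leaves]; omega
      · simp [Tree.prods, h2, hr]
      · simp [Tree.deltas, h2', hr']
      · exact h1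
      · exact h1'
      · exact fun i j l' hp => h i j l' (hp.trans (perm_rotate _ _ _))
    cases T with
    | leaf a => simp [Tree.prods] at hT
    | delta t => simp [Tree.deltas] at hT'
    | node d l r =>
      simp only [Tree.deltas, Nat.add_eq_zero_iff] at hT'
      simp only [Tree.leaves, List.length_append] at hN
      simp only [Tree.leaves] at h
      cases d
      · simp only [Tree.prods, if_true] at hT
        have hl : l.prods = 0 := by omega
        have hr : r.prods = 0 := by omega
        simp only [prodSum, if_true, prodSum_eq_zero w hl, prodSum_eq_zero w hr, add_zero]
        cases l with
        | delta t => simp [Tree.deltas] at hT'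
        | node d l₁ l₂ =>
          cases d
          · simp [Tree.prods] at hl
          simp only [Tree.prods, reduceCtorEq, if_false, zero_add, Nat.add_eq_zero_iff] at hl
          simp only [Tree.deltas, Nat.add_eq_zero_iff] at hT'
          simp only [Tree.leaves, List.length_append] at hN h
          exact key' l₁ l₂ r K hN hl.1 hl.2 hT'.1.1 hT'.1.2 hr hT'.2 h
        | leaf i =>
          cases r with
          | delta t => simp [Tree.deltas] at hT'
          | leaf j => simpa [cross, Tree.leaves] using h i j [] (List.Perm.refl _)
          | node d r₁ r₂ =>
            cases d
            · simp [Tree.prods] at hr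
            rw [hc.node_comm .prod (by simp [hl]) K, cross_comm hw]
            simp only [Tree.prods, reduceCtorEq, if_false, zero_add, Nat.add_eq_zero_iff] at hr
            simp only [Tree.deltas, Nat.add_eq_zero_iff] at hT'
            simp only [Tree.leaves, List.length_append] at hN h
            refine key' r₁ r₂ (.leaf i) K ?_ hr.1 hr.2 hT'.2.1 hT'.2.2 hl rfl ?_
            · simp only [Tree.leaves]; omega
            · exact fun i j l' hp => h i j l' (hp.trans List.perm_append_comm)
      · simp only [Tree.prods, reduceCtorEq, if_false, zero_add] at hT
        simp only [prodSum, reduceCtorEq, if_false, zero_add]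
        rcases Nat.eq_zero_or_pos r.prods with hr | hr
        · rw [prodSum_eq_zero w hr, add_zero]
          exact key l r K hN (by omega) hT'.1 hr hT'.2 h
        · have hl : l.prods = 0 := by omega
          rw [prodSum_eq_zero w hl, zero_add, hc.node_comm .brk (by simp [hl]) K]
          exact key r l K (by omega) (by omega) hT'.2 hl hT'.1
            fun i j l' hp => h i j l' (hp.trans List.perm_append_comm)

end

section

/-! ## Linear coordinates of vertex forms -/

section Coordinates

variable {α : Type} {V : Type*} [AddCommGroup V] [Module ℂ V]

theorem algebraMapInv_ι (v : V) :
    ExteriorAlgebra.algebraMapInv (ExteriorAlgebra.ι ℂ v) = (0 : ℂ) := by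
  simp [ExteriorAlgebra.algebraMapInv]

/-- The coordinate `d` of the component of degree one. -/
def linCoord (d : V →ₗ[ℂ] ℂ) : ExteriorAlgebra ℂ V →ₗ[ℂ] ℂ :=
  ExteriorAlgebra.algebraMapInv.toLinearMap ∘ₗ
    CliffordAlgebra.contractLeft (Q := (0 : QuadraticForm ℂ V)) d

theorem contractLeft_ι_mul' (d : Module.Dual ℂ V) (v : V) (x : ExteriorAlgebra ℂ V) :
    CliffordAlgebra.contractLeft (Q := (0 : QuadraticForm ℂ V)) d (ExteriorAlgebra.ι ℂ v * x) =
      d v • x - ExteriorAlgebra.ι ℂ v *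
        CliffordAlgebra.contractLeft (Q := (0 : QuadraticForm ℂ V)) d x :=
  CliffordAlgebra.contractLeft_ι_mul d v x

theorem linCoord_ι_mul (d : V →ₗ[ℂ] ℂ) (v : V) (x : ExteriorAlgebra ℂ V) :
    linCoord d (ExteriorAlgebra.ι ℂ v * x) = d v * ExteriorAlgebra.algebraMapInv x := by
  simp only [linCoord, LinearMap.comp_apply, contractLeft_ι_mul', AlgHom.toLinearMap_apply,
    map_sub, map_smul, map_mul, algebraMapInv_ι, zero_mul, sub_zero, smul_eq_mul]

theorem linCoord_one (d : V →ₗ[ℂ] ℂ) : linCoord d 1 = 0 := by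
  have : CliffordAlgebra.contractLeft (Q := (0 : QuadraticForm ℂ V)) d 1 = 0 :=
    CliffordAlgebra.contractLeft_one 0 d
  change ExteriorAlgebra.algebraMapInv _ = _
  rw [this, map_zero]

/-- The degree-one part of a product only involves the parts of degree zero and one of the factors.
-/
theorem linCoord_mul (d : V →ₗ[ℂ] ℂ) (x y : ExteriorAlgebra ℂ V) :
    linCoord d (x * y) = linCoord d x * ExteriorAlgebra.algebraMapInv y +
      ExteriorAlgebra.algebraMapInv x * linCoord d y := by
  induction x using CliffordAlgebra.left_induction with
  | algebraMap r =>
    rw [← Algebra.smul_def, map_smul, AlgHom.commutes, Algebra.algebraMap_eq_smul_one,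
      map_smul, linCoord_one]
    simp
  | add x x' h h' => rw [add_mul, map_add, map_add, map_add, h, h']; ring
  | ι_mul x v h =>
    change linCoord d (ExteriorAlgebra.ι ℂ v * x * y) =
      linCoord d (ExteriorAlgebra.ι ℂ v * x) * _ +
        ExteriorAlgebra.algebraMapInv (ExteriorAlgebra.ι ℂ v * x) * _
    rw [mul_assoc, linCoord_ι_mul, linCoord_ι_mul, map_mul, map_mul, algebraMapInv_ι]
    ring

theorem algebraMapInv_vertexForm (e : α → α → V) (T : Tree α) :
    ExteriorAlgebra.algebraMapInv (vertexForm e T) = if T.prods = 0 then (1 : ℂ) else 0 := by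
  induction T with
  | leaf a => simp [vertexForm, Tree.prods]
  | delta t ih => exact ih
  | node d l r ihl ihr =>
    cases d
    · simp [vertexForm, Tree.prods, algebraMapInv_ι]
    · by_cases h : l.prods = 0 <;> by_cases h' : r.prods = 0 <;>
        simp [vertexForm, Tree.prods, ihl, ihr, h, h']

/-- This recovers from vertex forms the coefficients `prodSum` of an arbitrary element with one
product. -/
theorem linCoord_vertexForm (d : V →ₗ[ℂ] ℂ) (e : α → α → V) (T : Tree α) :
    linCoord d (vertexForm e T) =
      if T.prods = 1 then prodSum (fun i j => d (e i j)) T else 0 := by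
  induction T with
  | leaf a => simp [vertexForm, Tree.prods, linCoord_one]
  | delta t ih => exact ih
  | node b l r ihl ihr =>
    cases b
    · simp only [vertexForm, mul_assoc, linCoord_ι_mul, map_mul, algebraMapInv_vertexForm,
        Tree.prods, prodSum, if_true]
      rw [map_cross d]
      by_cases h : l.prods = 0 <;> by_cases h' : r.prods = 0
      · simp [h, h', prodSum_eq_zero]
      · simp [h, h']
      · simp [h, h']
      · simp [h, h', show 1 + l.prods + r.prods ≠ 1 by omega]
    · simp only [vertexForm, linCoord_mul, ihl, ihr, algebraMapInv_vertexForm, Tree.prods,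
        prodSum, reduceCtorEq, if_false, zero_add]
      by_cases h : l.prods = 0 <;> by_cases h' : r.prods = 0
      · simp [h, h']
      · by_cases h'' : r.prods = 1 <;> simp [h, h', h'', prodSum_eq_zero]
      · by_cases h'' : l.prods = 1 <;> simp [h, h', h'', prodSum_eq_zero]
      · have : l.prods + r.prods ≠ 1 := by omega
        simp [h, h', this]

end Coordinates

/-! ## The cogenerators -/

theorem Tree.length_leaves {α : Type} (T : Tree α) :
    T.leaves.length = T.prods + T.brks + 1 := by
  induction T with
  | leaf a => rfl
  | delta t ih => exact ih
  | node d l r ihl ihr =>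
    cases d <;> simp [Tree.leaves, Tree.prods, Tree.brks, ihl, ihr] <;> ring

variable {k : ℕ}

theorem prods_add_brks {T : Tree (Fin k)} (h : T.leaves.Perm (List.finRange k)) :
    T.prods + T.brks + 1 = k := by
  rw [← T.length_leaves, h.length_eq, List.length_finRange]

theorem pairTree_eq_comb (i j : Fin k) : pairTree i j =
    comb (.node .prod (.leaf i) (.leaf j))
      ((List.finRange k).filter fun a => a ≠ i ∧ a ≠ j) := rfl

/-- The coefficients of the trees `pairTree i j`. -/
def pairCoeff (c : Tree (Fin k) → ℂ) (i j : Fin k) : ℂ := if i = j then 0 else c (pairTree i j)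

theorem pairCoeff_self (c : Tree (Fin k) → ℂ) (i : Fin k) : pairCoeff c i i = 0 := if_pos rfl

theorem pairSum_finRange {w : Fin k → Fin k → ℂ} (hw : ∀ i j, w i j = w j i)
    (hw' : ∀ i, w i i = 0) :
    pairSum w (List.finRange k) = ∑ i, ∑ j ∈ Finset.Ioi i, w i j := by
  have h := Finset.sum_sum_Ioi_add_eq_sum_sum_off_diag w
  have h2 : ∀ i, ∑ j ∈ {i}ᶜ, w j i = ∑ j, w i j := fun i => by
    rw [← Finset.sum_compl_add_sum {i}, Finset.sum_singleton, hw', add_zero]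
    exact Finset.sum_congr rfl fun j _ => hw j i
  simp only [h2, Finset.sum_add_distrib] at h
  simp only [pairSum, cross, ← Fin.sum_univ_def, ← h, smul_eq_mul]
  rw [Finset.sum_congr rfl fun i _ => Finset.sum_congr rfl fun j _ => hw j i]
  ring

namespace IsKoszulDual

variable {c : Tree (Fin k) → ℂ}

theorem pairCoeff_comm (hc : IsKoszulDual c) (i j : Fin k) : pairCoeff c i j = pairCoeff c j i := by
  unfold pairCoeff
  by_cases h : i = j
  · simp [h]
  rw [if_neg h, if_neg (Ne.symm h), pairTree_eq_comb, pairTree_eq_comb]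
  simp only [and_comm (a := _ ≠ i)]
  exact (hc.node_comm .prod (by simp [Tree.prods])).comb _ .hole

theorem apply_eq_prodSum (hc : IsKoszulDual c) {T : Tree (Fin k)} (hT : T.prods = 1)
    (hT' : T.deltas = 0) (hp : T.leaves.Perm (List.finRange k)) :
    c T = prodSum (pairCoeff c) T := by
  -- At the root the remaining labels `l` are all labels other than `i` and `j` in some order, so
  -- `comb_perm` identifies the comb with `pairTree i j`.
  refine hc.plug_eq_prodSum hc.pairCoeff_comm _ T le_rfl hT hT' .hole fun i j l hl => ?_
  have hl' := hl.trans hp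
  have hn : (i :: j :: l).Nodup := hl'.nodup_iff.2 (List.nodup_finRange k)
  simp only [List.nodup_cons, List.mem_cons, not_or] at hn
  rw [pairCoeff, if_neg hn.1.1, pairTree_eq_comb]
  refine hc.comb_perm (by simp [Tree.prods]) ?_ .hole
  refine (List.perm_ext_iff_of_nodup hn.2.2 ((List.nodup_finRange k).filter _)).2 fun a => ?_
  have ha : a ∈ i :: j :: l := hl'.mem_iff.2 (List.mem_finRange a)
  simp only [List.mem_cons] at ha
  simp only [List.mem_filter, List.mem_finRange, true_and, decide_eq_true_eq]
  constructor
  · intro h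
    exact ⟨fun h' => hn.1.2 (h' ▸ h), fun h' => hn.2.1 (h' ▸ h)⟩
  · rintro ⟨h1, h2⟩
    exact (ha.resolve_left h1).resolve_left h2

end IsKoszulDual

theorem cogen_eq_pairSum (c : BVcoDelta k 0) :
    cogen k c = pairSum (pairCoeff c.1) (List.finRange k) := by
  have hc : IsKoszulDual c.1 := c.2.1
  rw [pairSum_finRange hc.pairCoeff_comm (pairCoeff_self _)]
  simp only [cogen, LinearMap.comp_apply, LinearMap.sum_apply, LinearMap.proj_apply,
    Submodule.subtype_apply]
  refine Finset.sum_congr rfl fun i _ => Finset.sum_congr rfl fun j hj => ?_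
  rw [pairCoeff, if_neg (Finset.mem_Ioi.1 hj).ne]

/-- Only trees with one product enter the polarization, and on these `c` is a sum of pair
coefficients; summing over all vertices of `T` collects every pair once. -/
theorem polar_eq_cogen (c : BVcoDelta k 0) {T : Tree (Fin k)} (hT : T.prods = 0)
    (hT' : T.deltas = 0) (hp : T.leaves.Perm (List.finRange k)) : polar T c.1 = cogen k c := by
  have hc : IsKoszulDual c.1 := c.2.1
  rw [cogen_eq_pairSum, ← pairSum_perm _ hp,
    ← polar_prodSum hc.pairCoeff_comm (pairCoeff_self _) hT]
  refine polar_congr T fun T' h1 h2 h3 => hc.apply_eq_prodSum (by omega) (by omega) ?_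
  rwa [h1]

theorem exists_tree_prods_eq_zero (hk : 0 < k) : ∃ T : Tree (Fin k), T.prods = 0 ∧ T.deltas = 0 ∧
    T.leaves.Perm (List.finRange k) := by
  obtain ⟨m, rfl⟩ : ∃ m, k = m + 1 := ⟨k - 1, by omega⟩
  refine ⟨comb (.leaf 0) ((List.finRange m).map Fin.succ), by simp [Tree.prods],
    by simp [Tree.deltas], ?_⟩
  rw [leaves_comb, List.finRange_succ]
  rfl

/-- The cogenerators vanish on boundaries. -/
theorem cogen_eq_zero_of_mem_boundaries (hk : 0 < k) {c : BVcoDelta k 0}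
    (hc : c ∈ boundaries k) : cogen k c = 0 := by
  obtain ⟨y, hy, hyc⟩ := Submodule.mem_map.1 (Submodule.mem_comap.1 hc)
  obtain ⟨T, hT, hT', hp⟩ := exists_tree_prods_eq_zero hk
  have hy' : IsKoszulDual y := hy.1
  have hyc' : diff k y = c.1 := hyc
  -- The boundary is itself the polarization of `t ↦ y (Δ t)`, so its cogenerator is a double
  -- polarization.
  rw [← polar_eq_cogen c hT hT' hp, ← polar_polar T fun t => y (.delta t), ← hyc']
  refine polar_congr T fun T' _ _ h3 => ?_
  exact diffCoeff_eq_polar y hy'.delta_left hy'.delta_right T' (by omega) .hole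

/-! ## Exactness for at most one product -/

/-- A symmetric function of pairs with total sum one. -/
def unitPair (k : ℕ) (i j : Fin k) : ℂ := if i = j then 0 else 2 / (k * (k - 1))

theorem unitPair_comm (i j : Fin k) : unitPair k i j = unitPair k j i := by
  simp [unitPair, eq_comm]

theorem unitPair_self (i : Fin k) : unitPair k i i = 0 := if_pos rfl

theorem pairSum_unitPair (hk : 2 ≤ k) : pairSum (unitPair k) (List.finRange k) = 1 := by
  have h1 : (k : ℂ) ≠ 0 := by exact_mod_cast (by omega : k ≠ 0)
  have h2 : (k : ℂ) - 1 ≠ 0 := sub_ne_zero.2 (by exact_mod_cast (by omega : k ≠ 1))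
  have h : ∀ i : Fin k, ∑ j, unitPair k i j = 2 / k := fun i => by
    have : ∀ j, unitPair k i j = 2 / (k * (k - 1)) -
        if i = j then 2 / ((k : ℂ) * (k - 1)) else 0 := by
      intro j
      by_cases h : i = j <;> simp [unitPair, h]
    simp only [this, Finset.sum_sub_distrib, Finset.sum_ite_eq, Finset.mem_univ, if_true,
      Finset.sum_const, Finset.card_univ, Fintype.card_fin, nsmul_eq_mul]
    field_simp
  simp only [pairSum, cross, ← Fin.sum_univ_def, h, Finset.sum_const, Finset.card_univ,
    Fintype.card_fin, nsmul_eq_mul, smul_eq_mul]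
  field_simp

/-- Both sides vanish on trees with wrong labels or with a `Δ`. -/
theorem BVcoDelta.ext_formCoeff {V : Type*} [AddCommGroup V] [Module ℂ V]
    {e : Fin k → Fin k → V} {φ : ExteriorAlgebra ℂ V →ₗ[ℂ] ℂ} (c : BVcoDelta k 0)
    (h : ∀ T : Tree (Fin k), T.leaves.Perm (List.finRange k) → T.deltas = 0 →
      φ (vertexForm e T) = c.1 T) : formCoeff e φ 0 = c.1 := by
  classical
  funext T
  by_cases hT : T.leaves.Perm (List.finRange k) ∧ T.deltas = 0
  · rw [formCoeff_of_pos hT.1 hT.2, h T hT.1 hT.2]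
  · rw [show formCoeff e φ 0 T = 0 from if_neg hT]
    by_contra h0
    refine hT ⟨c.2.1.labels T (Ne.symm h0), ?_⟩
    by_contra h1
    exact h0 (c.2.2 T h1).symm

/-- The elements with brackets only are boundaries. -/
theorem mem_boundaries_of_prods_eq_zero (hk : 2 ≤ k) {c : BVcoDelta k 0}
    (hc : ∀ T, c.1 T ≠ 0 → T.prods = 0) : c ∈ boundaries k := by
  obtain ⟨T₀, h₀, h₀', hp₀⟩ := exists_tree_prods_eq_zero (k := k) (by omega)
  refine Submodule.mem_comap.2 (Submodule.mem_map.2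
    -- Here `V = ℂ` and the sum over all pairs is `1`. Composed with multiplication by it,
    -- `linCoord` becomes the augmentation, which is `1` on trees with brackets only and `0` on the
    -- others; `c.1 T₀` is the common value of `c` on the former.
    ⟨formCoeff (unitPair k) (c.1 T₀ • linCoord LinearMap.id) 1,
      formCoeff_mem unitPair_comm _ _, ?_⟩)
  rw [diff_formCoeff unitPair_comm unitPair_self]
  refine BVcoDelta.ext_formCoeff c fun T hp hT => ?_
  simp only [LinearMap.comp_apply, LinearMap.smul_apply, LinearMap.mulLeft_apply, linCoord_ι_mul,
    algebraMapInv_vertexForm, pairSum_unitPair hk, LinearMap.id_apply, smul_eq_mul]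
  by_cases h : T.prods = 0
  · have hK : IsKoszulDual c.1 := c.2.1
    rw [hK.apply_eq_of_prods_eq_zero (by omega) h h₀ hT h₀' hp hp₀]
    simp [h]
  · have : c.1 T = 0 := by
      by_contra h'
      exact h (hc T h')
    simp [h, this]

/-- The elements with one product on which the cogenerators vanish are boundaries. -/
theorem mem_boundaries_of_prods_eq_one (hk : 2 ≤ k) {c : BVcoDelta k 0}
    (hc : ∀ T, c.1 T ≠ 0 → T.prods = 1) (h0 : cogen k c = 0) : c ∈ boundaries k := by
  have hK : IsKoszulDual c.1 := c.2.1
  -- The first coordinate records `c`; the second makes the sum over all pairs nonzero. Vanishing of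
  -- the cogenerator makes this sum exactly `(0, 1)`.
  set e : Fin k → Fin k → ℂ × ℂ := fun i j => (pairCoeff c.1 i j, unitPair k i j) with he
  have he1 : ∀ i j, e i j = e j i := fun i j => by
    simp [he, hK.pairCoeff_comm i j, unitPair_comm i j]
  have he2 : ∀ i, e i i = 0 := fun i => by simp [he, pairCoeff_self, unitPair_self]
  have hE : pairSum e (List.finRange k) = (0, 1) := by
    have h1 := map_pairSum (LinearMap.fst ℂ ℂ ℂ) e (List.finRange k)
    have h2 := map_pairSum (LinearMap.snd ℂ ℂ ℂ) e (List.finRange k)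
    rw [cogen_eq_pairSum] at h0
    exact Prod.ext (h1.trans h0) (h2.trans (pairSum_unitPair hk))
  refine Submodule.mem_comap.2 (Submodule.mem_map.2
    -- Contraction with the second coordinate undoes multiplication by `(0, 1)` up to a multiple of
    -- `(0, 1)`, which the first linear coordinate kills. What is left is the first coordinate of
    -- the vertex form, that is, `c`.
    ⟨formCoeff e (linCoord (LinearMap.fst ℂ ℂ ℂ) ∘ₗ CliffordAlgebra.contractLeft
        (Q := (0 : QuadraticForm ℂ (ℂ × ℂ))) (LinearMap.snd ℂ ℂ ℂ)) 1,
      formCoeff_mem he1 _ _, ?_⟩)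
  rw [diff_formCoeff he1 he2]
  refine BVcoDelta.ext_formCoeff c fun T hp hT => ?_
  simp only [LinearMap.comp_apply, LinearMap.mulLeft_apply, contractLeft_ι_mul', map_sub, hE,
    linCoord_ι_mul, LinearMap.fst_apply, LinearMap.snd_apply, zero_mul, sub_zero, one_smul,
    linCoord_vertexForm]
  by_cases h : T.prods = 1
  · rw [if_pos h, hK.apply_eq_prodSum h hT hp]
  · rw [if_neg h]
    by_contra hne
    exact h (hc T (Ne.symm hne))

/-- A homogeneous representative of a nonzero higher homotopy operation has fewer than `k - 2`
brackets. -/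
theorem brackets_lt_of_mem_higherOps (hk : 2 ≤ k) {c : BVcoDelta k 0} {ℓ : ℕ}
    (hℓ : HomogeneousBrackets c ℓ) (hc : (boundaries k).mkQ c ≠ 0)
    (h : (boundaries k).mkQ c ∈ higherOps k) : (ℓ : ℤ) < (k : ℤ) - 2 := by
  have hc' : c ∉ boundaries k := fun h => hc ((Submodule.Quotient.mk_eq_zero _).2 h)
  have hcount : ∀ T, c.1 T ≠ 0 → T.prods + ℓ + 1 = k := fun T hT => by
    rw [← hℓ T hT]
    exact prods_add_brks (c.2.1.labels T hT)
  obtain ⟨T, hT⟩ : ∃ T, c.1 T ≠ 0 := by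
    by_contra! h0
    exact hc' ((Subtype.ext (funext h0) : c = 0) ▸ zero_mem _)
  have h1 := hcount T hT
  by_contra! hlt
  -- With `prods + ℓ = k - 1`, failure of the bound leaves at most one product.
  have h2 : T.prods = 0 ∨ T.prods = 1 := by omega
  rcases h2 with h2 | h2
  · exact hc' (mem_boundaries_of_prods_eq_zero hk fun T' hT' => by have := hcount T' hT'; omega)
  · refine hc' (mem_boundaries_of_prods_eq_one hk
      (fun T' hT' => by have := hcount T' hT'; omega) ?_)
    -- The kernel is defined through some representative `c'`; since the cogenerator vanishes on
    -- boundaries, it vanishes on `c` as well.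
    obtain ⟨c', h3, h4⟩ := Submodule.mem_map.1 h
    have h5 : c - c' ∈ boundaries k := (Submodule.Quotient.eq _).1 h4.symm
    have h6 := cogen_eq_zero_of_mem_boundaries (by omega) h5
    rwa [map_sub, LinearMap.mem_ker.1 h3, sub_zero] at h6

/-- A homogeneous representative of a class that is not a higher homotopy operation has `k - 2`
brackets. -/
theorem brackets_eq_of_notMem_higherOps {c : BVcoDelta k 0} {ℓ : ℕ}
    (hℓ : HomogeneousBrackets c ℓ) (h : (boundaries k).mkQ c ∉ higherOps k) :
    (ℓ : ℤ) = (k : ℤ) - 2 := by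
  have h0 : cogen k c ≠ 0 := fun h0 => h (Submodule.mem_map.2 ⟨c, h0, rfl⟩)
  simp only [cogen, LinearMap.comp_apply, LinearMap.sum_apply, LinearMap.proj_apply,
    Submodule.subtype_apply] at h0
  -- A nonzero cogenerator needs a tree `pairTree i j` in the support of `c`, and that tree has one
  -- product.
  obtain ⟨i, _, hi⟩ := Finset.exists_ne_zero_of_sum_ne_zero h0
  obtain ⟨j, _, hj⟩ := Finset.exists_ne_zero_of_sum_ne_zero hi
  have h1 := prods_add_brks (c.2.1.labels _ hj)
  rw [hℓ _ hj, pairTree_eq_comb, prods_comb] at h1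
  simp only [Tree.prods, if_true] at h1
  omega

end

section

/-! ## Rescaling of the fibres

The torus acts on the fibres by rescaling the generators `dz` (or `∂/∂z`) and `dz̄`. All the
operators below are equivariant, and bidegrees are weights of this action. -/

/-- A bijection matching the two properties matches their unique solutions. The default value `0` is
matched too because `g 0 = 0`, so equivariance holds without knowing that a solution exists. -/
theorem theUnique_map {α : Type*} [Zero α] {P P' : α → Prop} (g : α ≃ α) (hg : g 0 = 0)
    (h : ∀ a, P' (g a) ↔ P a) : theUnique P' = g (theUnique P) := by
  classical
  by_cases hP : ∃! a, P a
  · have hP' : ∃! a, P' a := by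
      obtain ⟨a, ha, hu⟩ := hP
      refine ⟨g a, (h a).2 ha, fun b hb => ?_⟩
      rw [← g.apply_symm_apply b] at hb ⊢
      rw [hu _ ((h _).1 hb)]
    rw [theUnique, theUnique, dif_pos hP, dif_pos hP']
    exact hP'.unique hP'.choose_spec.1 ((h _).2 hP.choose_spec.1)
  · have hP' : ¬ ∃! a, P' a := by
      rintro ⟨a, ha, hu⟩
      refine hP ⟨g.symm a, (h _).1 (by rwa [g.apply_symm_apply]), fun b hb => ?_⟩
      rw [← hu _ ((h b).2 hb), g.symm_apply_apply]
    rw [theUnique, theUnique, dif_neg hP, dif_neg hP', hg]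

variable {n : ℕ}

/-- Multiplication of the generators `dz` by `a` and of the generators `dz̄` by `b`. -/
def scaleCoef (n : ℕ) (a b : Circle) : Coef n →ₗ[ℂ] Coef n :=
  LinearMap.prodMap ((b : ℂ) • LinearMap.id) ((a : ℂ) • LinearMap.id)

theorem scaleCoef_apply (a b : Circle) (m : Coef n) :
    scaleCoef n a b m = ((b : ℂ) • m.1, (a : ℂ) • m.2) := rfl

/-- The automorphism of the fibre that multiplies `dz` by `a` and `dz̄` by `b`. -/
def scaleFib (n : ℕ) (a b : Circle) : Fib n →ₐ[ℂ] Fib n := ExteriorAlgebra.map (scaleCoef n a b)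

theorem scaleFib_ι (a b : Circle) (m : Coef n) :
    scaleFib n a b (ExteriorAlgebra.ι ℂ m) =
      ExteriorAlgebra.ι ℂ ((b : ℂ) • m.1, (a : ℂ) • m.2) := ExteriorAlgebra.map_apply_ι _ _

theorem scaleFib_inv (a b : Circle) (x : Fib n) : scaleFib n a⁻¹ b⁻¹ (scaleFib n a b x) = x := by
  have h : (scaleFib n a⁻¹ b⁻¹).comp (scaleFib n a b) = AlgHom.id ℂ (Fib n) := by
    refine ExteriorAlgebra.hom_ext (LinearMap.ext fun m => ?_)
    simp only [LinearMap.comp_apply, AlgHom.toLinearMap_apply, AlgHom.comp_apply, scaleFib_ι,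
      smul_smul, ← Circle.coe_mul, inv_mul_cancel, Circle.coe_one, one_smul]
    rfl
  exact DFunLike.congr_fun h x

instance : FiniteDimensional ℂ (Fib n) := (fibCoord n).symm.finiteDimensional

/-- The composition of `scaleFib` with the multiplication by `c`. -/
def twistFib (n : ℕ) (c : ℂˣ) (a b : Circle) : Fib n ≃L[ℂ] Fib n :=
  LinearEquiv.toContinuousLinearEquiv <| LinearEquiv.ofLinearMap
    ((c : ℂ) • (scaleFib n a b).toLinearMap) (((c⁻¹ : ℂˣ) : ℂ) • (scaleFib n a⁻¹ b⁻¹).toLinearMap)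
    (LinearMap.ext fun x => by
      have := scaleFib_inv a⁻¹ b⁻¹ x
      rw [inv_inv, inv_inv] at this
      simp [this])
    (LinearMap.ext fun x => by simp [scaleFib_inv])

theorem twistFib_apply (c : ℂˣ) (a b : Circle) (x : Fib n) :
    twistFib n c a b x = (c : ℂ) • scaleFib n a b x := rfl

theorem twistFib_mul (c c' : ℂˣ) (a b : Circle) (x y : Fib n) :
    twistFib n c a b x * twistFib n c' a b y = twistFib n (c * c') a b (x * y) := by
  simp only [twistFib_apply, map_mul, smul_mul_smul_comm, Units.val_mul]

/-- The generator `dz̄` has weight `b`, which the scalar has to compensate. -/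
theorem dzbar_mul_twistFib (i : Fin n) (c : ℂˣ) (a b : Circle) (x : Fib n) :
    dzbar i * twistFib n c a b x =
      twistFib n (c * (Circle.toUnits b)⁻¹) a b (dzbar i * x) := by
  have h : scaleFib n a b (dzbar i) = (b : ℂ) • dzbar i := by
    rw [dzbar, scaleFib_ι, ← map_smul]
    simp
  simp [twistFib_apply, map_mul, h, smul_smul]

theorem dz_mul_twistFib (i : Fin n) (c : ℂˣ) (a b : Circle) (x : Fib n) :
    dz i * twistFib n c a b x =
      twistFib n (c * (Circle.toUnits a)⁻¹) a b (dz i * x) := by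
  have h : scaleFib n a b (dz i) = (a : ℂ) • dz i := by
    rw [dz, scaleFib_ι, ← map_smul]
    simp
  simp [twistFib_apply, map_mul, h, smul_smul]

theorem involute_twistFib (c : ℂˣ) (a b : Circle) (x : Fib n) :
    CliffordAlgebra.involute (twistFib n c a b x) =
      twistFib n c a b (CliffordAlgebra.involute x) := by
  have h : (CliffordAlgebra.involute (Q := (0 : QuadraticForm ℂ (Coef n)))).comp
      (scaleFib n a b) = (scaleFib n a b).comp CliffordAlgebra.involute := by
    refine ExteriorAlgebra.hom_ext (LinearMap.ext fun m => ?_)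
    have hι : ∀ m : Coef n, CliffordAlgebra.involute (Q := (0 : QuadraticForm ℂ (Coef n)))
      (ExteriorAlgebra.ι ℂ m) = -ExteriorAlgebra.ι ℂ m := fun m => CliffordAlgebra.involute_ι m
    simp only [LinearMap.comp_apply, AlgHom.toLinearMap_apply, AlgHom.comp_apply, scaleFib_ι, hι,
      map_neg]
  have h' := DFunLike.congr_fun h x
  simp only [AlgHom.comp_apply] at h'
  rw [twistFib_apply, map_smul, h', twistFib_apply]

/-! ### Contractions and the polyvector action under rescaling -/

theorem contractLeft_map {V W : Type*} [AddCommGroup V] [Module ℂ V] [AddCommGroup W]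
    [Module ℂ W] (f : V →ₗ[ℂ] W) (d : Module.Dual ℂ W) (x : ExteriorAlgebra ℂ V) :
    CliffordAlgebra.contractLeft (Q := (0 : QuadraticForm ℂ W)) d (ExteriorAlgebra.map f x) =
      ExteriorAlgebra.map f
        (CliffordAlgebra.contractLeft (Q := (0 : QuadraticForm ℂ V)) (d ∘ₗ f) x) := by
  induction x using CliffordAlgebra.left_induction with
  | algebraMap r =>
    rw [AlgHom.commutes, CliffordAlgebra.contractLeft_algebraMap,
      CliffordAlgebra.contractLeft_algebraMap]
    exact (map_zero (ExteriorAlgebra.map f)).symm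
  | add x x' h h' => simp only [map_add, h, h']
  | ι_mul x v h =>
    change CliffordAlgebra.contractLeft (Q := (0 : QuadraticForm ℂ W)) d
      (ExteriorAlgebra.map f (ExteriorAlgebra.ι ℂ v * x)) = ExteriorAlgebra.map f
        (CliffordAlgebra.contractLeft (Q := (0 : QuadraticForm ℂ V)) (d ∘ₗ f)
          (ExteriorAlgebra.ι ℂ v * x))
    rw [map_mul, ExteriorAlgebra.map_apply_ι, contractLeft_ι_mul', contractLeft_ι_mul', h,
      map_sub, map_smul, map_mul, ExteriorAlgebra.map_apply_ι, LinearMap.comp_apply]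

theorem contr_scaleFib (v : Fin n → ℂ) (a b : Circle) (x : Fib n) :
    contr v (scaleFib n a b x) = (a : ℂ) • scaleFib n a b (contr v x) := by
  have h : ((Fintype.linearCombination ℂ v) ∘ₗ LinearMap.snd ℂ (Fin n → ℂ) (Fin n → ℂ)) ∘ₗ
      scaleCoef n a b = (a : ℂ) • ((Fintype.linearCombination ℂ v) ∘ₗ
        LinearMap.snd ℂ (Fin n → ℂ) (Fin n → ℂ)) := LinearMap.ext fun m => by
    simp only [LinearMap.comp_apply, LinearMap.smul_apply, LinearMap.snd_apply, scaleCoef_apply,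
      map_smul]
  rw [contr, scaleFib, contractLeft_map, h, map_smul, LinearMap.smul_apply, map_smul]

theorem contrBar_scaleFib (v : Fin n → ℂ) (a b : Circle) (x : Fib n) :
    contrBar v (scaleFib n a b x) = (b : ℂ) • scaleFib n a b (contrBar v x) := by
  have h : ((Fintype.linearCombination ℂ (fun i => conj (v i))) ∘ₗ
      LinearMap.fst ℂ (Fin n → ℂ) (Fin n → ℂ)) ∘ₗ scaleCoef n a b =
      (b : ℂ) • ((Fintype.linearCombination ℂ (fun i => conj (v i))) ∘ₗ
        LinearMap.fst ℂ (Fin n → ℂ) (Fin n → ℂ)) := LinearMap.ext fun m => by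
    simp only [LinearMap.comp_apply, LinearMap.smul_apply, LinearMap.fst_apply, scaleCoef_apply,
      map_smul]
  rw [contrBar, scaleFib, contractLeft_map, h, map_smul, LinearMap.smul_apply, map_smul]

theorem contr_smul (z : ℂ) (v : Fin n → ℂ) : contr (z • v) = z • contr v := by
  have : Fintype.linearCombination ℂ (z • v) = z • Fintype.linearCombination ℂ v := by
    ext; simp [Fintype.linearCombination_apply, Finset.mul_sum, mul_left_comm]
  rw [contr, this, LinearMap.smul_comp, map_smul, contr]

/-- Vectors are dual to the `dz`: rescaling `∂/∂z` by `a` corresponds to rescaling `dz` by `a⁻¹`,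
and the two factors cancel in a contraction. -/
theorem polyAction_scaleFib (a b : Circle) (s σ : Fib n) :
    polyAction n (scaleFib n a b s) (scaleFib n a⁻¹ b σ) =
      scaleFib n a⁻¹ b (polyAction n s σ) := by
  induction s using ExteriorAlgebra.induction generalizing σ with
  | algebraMap r => simp [Module.algebraMap_end_apply]
  | ι m =>
    rw [scaleFib_ι]
    simp only [polyAction, ExteriorAlgebra.lift_ι_apply, polyActionGen, LinearMap.coe_mk,
      AddHom.coe_mk, LinearMap.add_apply, LinearMap.mulLeft_apply, contr_smul,
      LinearMap.smul_apply, contr_scaleFib, smul_smul, ← Circle.coe_mul, mul_inv_cancel,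
      Circle.coe_one, one_smul, map_add, map_mul, scaleFib_ι, smul_zero]
  | mul x y hx hy => simp only [map_mul, Module.End.mul_apply, hx, hy]
  | add x y hx hy => simp only [map_add, LinearMap.add_apply, hx, hy]

theorem polyAction_twistFib (c c' : ℂˣ) (a b : Circle) (s σ : Fib n) :
    polyAction n (twistFib n c a b s) (twistFib n c' a⁻¹ b σ) =
      twistFib n (c * c') a⁻¹ b (polyAction n s σ) := by
  simp only [twistFib_apply, map_smul, LinearMap.smul_apply, polyAction_scaleFib, smul_smul,
    Units.val_mul, mul_comm (c : ℂ)]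

theorem foldr_contr_scaleFib (f : Fin n → Fin n → ℂ) (l : List (Fin n)) (a b : Circle)
    (x : Fib n) : l.foldr (fun i τ => contr (f i) τ) (scaleFib n a b x) =
      (a : ℂ) ^ l.length • scaleFib n a b (l.foldr (fun i τ => contr (f i) τ) x) := by
  induction l with
  | nil => simp
  | cons i l ih =>
    simp only [List.foldr_cons, ih, map_smul, contr_scaleFib, smul_smul, List.length_cons,
      pow_succ]

theorem foldr_contrBar_scaleFib (f : Fin n → Fin n → ℂ) (l : List (Fin n)) (a b : Circle)
    (x : Fib n) : l.foldr (fun i τ => contrBar (f i) τ) (scaleFib n a b x) =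
      (b : ℂ) ^ l.length • scaleFib n a b (l.foldr (fun i τ => contrBar (f i) τ) x) := by
  induction l with
  | nil => simp
  | cons i l ih =>
    simp only [List.foldr_cons, ih, map_smul, contrBar_scaleFib, smul_smul, List.length_cons,
      pow_succ]

theorem foldr_contrBar_smul (f : Fin n → Fin n → ℂ) (l : List (Fin n)) (z : ℂ) (x : Fib n) :
    l.foldr (fun i τ => contrBar (f i) τ) (z • x) =
      z • l.foldr (fun i τ => contrBar (f i) τ) x := by
  induction l with
  | nil => rfl
  | cons i l ih => simp only [List.foldr_cons, ih, map_smul]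

theorem foldr_contr_smul (f : Fin n → Fin n → ℂ) (l : List (Fin n)) (z : ℂ) (x : Fib n) :
    l.foldr (fun i τ => contr (f i) τ) (z • x) =
      z • l.foldr (fun i τ => contr (f i) τ) x := by
  induction l with
  | nil => rfl
  | cons i l ih => simp only [List.foldr_cons, ih, map_smul]

theorem algebraMapInv_scaleFib (a b : Circle) (x : Fib n) :
    ExteriorAlgebra.algebraMapInv (scaleFib n a b x) = ExteriorAlgebra.algebraMapInv x := by
  have h : (ExteriorAlgebra.algebraMapInv (R := ℂ) (M := Coef n)).comp (scaleFib n a b) =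
      ExteriorAlgebra.algebraMapInv := by
    refine ExteriorAlgebra.hom_ext (LinearMap.ext fun m => ?_)
    simp only [LinearMap.comp_apply, AlgHom.toLinearMap_apply, AlgHom.comp_apply, scaleFib_ι,
      algebraMapInv_ι]
  exact DFunLike.congr_fun h x

/-- Apart from `c` the factor has modulus one and hence drops out of hermitian products; this is why
the torus is compact. -/
theorem formComp_twistFib (f : Fin n → Fin n → ℂ) (I J : Finset (Fin n)) (c : ℂˣ)
    (a b : Circle) (x : Fib n) : formComp f I J (twistFib n c a b x) =
      c * ((a ^ I.card * b ^ J.card : Circle) : ℂ) * formComp f I J x := by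
  simp only [formComp, twistFib_apply, foldr_contr_smul, foldr_contrBar_smul,
    foldr_contr_scaleFib, foldr_contrBar_scaleFib, map_smul, algebraMapInv_scaleFib,
    Finset.length_sort, smul_eq_mul, Circle.coe_mul, Circle.coe_pow]
  ring

/-! ## Bidegrees as weights -/

theorem bideg_of_nonneg (p q : ℕ) : bideg n p q =
    (LinearMap.range (ExteriorAlgebra.ι ℂ ∘ₗ LinearMap.inr ℂ (Fin n → ℂ) (Fin n → ℂ))) ^ p *
    (LinearMap.range (ExteriorAlgebra.ι ℂ ∘ₗ LinearMap.inl ℂ (Fin n → ℂ) (Fin n → ℂ))) ^ q := by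
  simp [bideg]

/-- Eigenspaces of an algebra automorphism multiply, and the two spaces of generators are contained
in the eigenspaces for `a` and `b`. -/
theorem scaleFib_of_mem_bideg {p q : ℤ} {x : Fib n} (hx : x ∈ bideg n p q) (a b : Circle) :
    scaleFib n a b x = ((a ^ p * b ^ q : Circle) : ℂ) • x := by
  by_cases hpq : 0 ≤ p ∧ 0 ≤ q
  swap
  · rw [bideg, if_neg hpq, Submodule.mem_bot] at hx
    simp [hx]
  obtain ⟨p, rfl⟩ := Int.eq_ofNat_of_zero_le hpq.1
  obtain ⟨q, rfl⟩ := Int.eq_ofNat_of_zero_le hpq.2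
  rw [bideg_of_nonneg] at hx
  set E : Circle → Submodule ℂ (Fib n) := fun z =>
    Module.End.eigenspace (scaleFib n a b).toLinearMap (z : ℂ) with hE
  have hE' : ∀ z x, x ∈ E z ↔ scaleFib n a b x = (z : ℂ) • x := fun z x =>
    Module.End.mem_eigenspace_iff
  have hmul : ∀ z w, E z * E w ≤ E (z * w) := fun z w => Submodule.mul_le.2 fun x hx y hy => by
    rw [hE'] at hx hy ⊢
    rw [map_mul, hx, hy, smul_mul_smul_comm, Circle.coe_mul]
  have hpow : ∀ (S : Submodule ℂ (Fib n)) (z : Circle) (m : ℕ), S ≤ E z → S ^ m ≤ E (z ^ m) := by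
    intro S z m h
    induction m with
    | zero =>
      rw [pow_zero, pow_zero, Submodule.one_le, hE']
      simp
    | succ m ih =>
      rw [pow_succ, pow_succ]
      exact (mul_le_mul' ih h).trans (hmul _ _)
  have hR : LinearMap.range (ExteriorAlgebra.ι ℂ ∘ₗ LinearMap.inr ℂ (Fin n → ℂ) (Fin n → ℂ)) ≤
      E a := by
    rintro _ ⟨v, rfl⟩
    rw [hE', LinearMap.comp_apply, scaleFib_ι, ← map_smul]
    simp
  have hL : LinearMap.range (ExteriorAlgebra.ι ℂ ∘ₗ LinearMap.inl ℂ (Fin n → ℂ) (Fin n → ℂ)) ≤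
      E b := by
    rintro _ ⟨v, rfl⟩
    rw [hE', LinearMap.comp_apply, scaleFib_ι, ← map_smul]
    simp
  have := (mul_le_mul' (hpow _ _ p hR) (hpow _ _ q hL)).trans (hmul _ _) hx
  simpa [hE'] using this

/-- The span contains the scalars and is stable under left multiplication by generators. For `dz̄`
this uses that the two spaces of generators commute as submodules (`hLR`). -/
theorem iSup_bideg (n : ℕ) : ⨆ s : ℤ × ℤ, bideg n s.1 s.2 = ⊤ := by
  set R := LinearMap.range (ExteriorAlgebra.ι ℂ ∘ₗ LinearMap.inr ℂ (Fin n → ℂ) (Fin n → ℂ))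
    with hR
  set L := LinearMap.range (ExteriorAlgebra.ι ℂ ∘ₗ LinearMap.inl ℂ (Fin n → ℂ) (Fin n → ℂ))
    with hL
  have hLR : Commute L R := by
    refine le_antisymm (Submodule.mul_le.2 ?_) (Submodule.mul_le.2 ?_)
    · rintro _ ⟨u, rfl⟩ _ ⟨v, rfl⟩
      simp only [LinearMap.comp_apply]
      rw [ι_mul_ι_comm]
      exact neg_mem (Submodule.mul_mem_mul ⟨v, rfl⟩ ⟨u, rfl⟩)
    · rintro _ ⟨u, rfl⟩ _ ⟨v, rfl⟩
      simp only [LinearMap.comp_apply]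
      rw [ι_mul_ι_comm]
      exact neg_mem (Submodule.mul_mem_mul ⟨v, rfl⟩ ⟨u, rfl⟩)
  have hmul : ∀ m : Coef n, ∀ x ∈ ⨆ s : ℤ × ℤ, bideg n s.1 s.2,
      ExteriorAlgebra.ι ℂ m * x ∈ ⨆ s : ℤ × ℤ, bideg n s.1 s.2 := by
    intro m x hx
    induction hx using Submodule.iSup_induction' with
    | zero => simp
    | add x y _ _ hx hy => rw [mul_add]; exact add_mem hx hy
    | mem s x hx =>
      obtain ⟨p, q⟩ := s
      by_cases hpq : 0 ≤ p ∧ 0 ≤ q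
      swap
      · rw [bideg, if_neg hpq, Submodule.mem_bot] at hx
        simp [hx]
      obtain ⟨p, rfl⟩ := Int.eq_ofNat_of_zero_le hpq.1
      obtain ⟨q, rfl⟩ := Int.eq_ofNat_of_zero_le hpq.2
      simp only [bideg_of_nonneg] at hx
      have hm : m = (0, m.2) + (m.1, 0) := by simp
      rw [hm, map_add, add_mul]
      refine add_mem ?_ ?_
      · refine Submodule.mem_iSup_of_mem (((p + 1 : ℕ) : ℤ), (q : ℤ)) ?_
        simp only [bideg_of_nonneg]
        rw [← hR, ← hL, pow_succ', mul_assoc]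
        exact Submodule.mul_mem_mul ⟨m.2, rfl⟩ hx
      · refine Submodule.mem_iSup_of_mem ((p : ℤ), ((q + 1 : ℕ) : ℤ)) ?_
        simp only [bideg_of_nonneg]
        rw [← hR, ← hL, pow_succ', ← mul_assoc, ← (hLR.pow_right p).eq, mul_assoc]
        exact Submodule.mul_mem_mul ⟨m.1, rfl⟩ hx
  refine eq_top_iff.2 fun x _ => ?_
  induction x using CliffordAlgebra.left_induction with
  | algebraMap r =>
    refine Submodule.mem_iSup_of_mem (((0 : ℕ) : ℤ), ((0 : ℕ) : ℤ)) ?_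
    simp only [bideg_of_nonneg, pow_zero, mul_one]
    exact Submodule.algebraMap_mem r
  | add x y hx hy => exact add_mem (hx trivial) (hy trivial)
  | ι_mul x m hx => exact hmul m x (hx trivial)

theorem exists_zpow_ne {m : ℤ} (hm : m ≠ 0) : ∃ a : Circle, a ^ m ≠ 1 := by
  -- Its `m`-th power is `exp(iπ) = -1`.
  refine ⟨Circle.exp (Real.pi / m), fun h => ?_⟩
  have h1 := congrArg (fun z : Circle => (z : ℂ)) h
  have hm' : (m : ℂ) ≠ 0 := by exact_mod_cast hm
  simp only [Circle.coe_zpow, Circle.coe_exp, Circle.coe_one, ← Complex.exp_int_mul] at h1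
  rw [show (m : ℂ) * (((Real.pi / m : ℝ) : ℂ) * Complex.I) = Real.pi * Complex.I by
    push_cast; field_simp, Complex.exp_pi_mul_I] at h1
  norm_num at h1

theorem exists_weight_ne {p q p' q' : ℤ} (h : (p, q) ≠ (p', q')) :
    ∃ a b : Circle, a ^ p * b ^ q ≠ a ^ p' * b ^ q' := by
  by_cases hp : p = p'
  · have hq : q - q' ≠ 0 := fun hq => h (by rw [hp, sub_eq_zero.1 hq])
    obtain ⟨b, hb⟩ := exists_zpow_ne hq
    refine ⟨1, b, fun h' => hb ?_⟩
    rw [zpow_sub]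
    simpa [mul_inv_eq_one] using h'
  · obtain ⟨a, ha⟩ := exists_zpow_ne (sub_ne_zero.2 hp)
    refine ⟨a, 1, fun h' => ha ?_⟩
    rw [zpow_sub]
    simpa [mul_inv_eq_one] using h'

/-- A weight vector lies in a finite sum of bidegrees, and the unwanted ones are removed one at a
time by a torus element that separates the two weights. -/
theorem mem_bideg_of_scaleFib {p q : ℤ} {x : Fib n}
    (hx : ∀ a b : Circle, scaleFib n a b x = ((a ^ p * b ^ q : Circle) : ℂ) • x) :
    x ∈ bideg n p q := by
  have key : ∀ S : Finset (ℤ × ℤ), (p, q) ∉ S →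
      x ∈ bideg n p q ⊔ ⨆ s ∈ S, bideg n s.1 s.2 → x ∈ bideg n p q := by
    intro S
    induction S using Finset.induction_on with
    | empty => intro _ h; simpa using h
    | insert s S hs ih =>
      intro hS h
      rw [Finset.mem_insert, not_or] at hS
      refine ih hS.2 ?_
      rw [Finset.iSup_insert, sup_left_comm] at h
      obtain ⟨y, hy, z, hz, hyz⟩ := Submodule.mem_sup.1 h
      obtain ⟨a, b, hab⟩ := exists_weight_ne (p := p) (q := q) (p' := s.1) (q' := s.2) hS.1
      set U := bideg n p q ⊔ ⨆ s ∈ S, bideg n s.1 s.2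
      have hstab : ∀ u ∈ U, scaleFib n a b u ∈ U := by
        have : U ≤ U.comap (scaleFib n a b).toLinearMap := by
          refine sup_le (fun u hu => ?_) (iSup₂_le fun t ht u hu => ?_)
          · rw [Submodule.mem_comap, AlgHom.toLinearMap_apply, scaleFib_of_mem_bideg hu]
            exact U.smul_mem _ (Submodule.mem_sup_left hu)
          · rw [Submodule.mem_comap, AlgHom.toLinearMap_apply, scaleFib_of_mem_bideg hu]
            exact U.smul_mem _ (Submodule.mem_sup_right
              (Submodule.mem_iSup_of_mem t (Submodule.mem_iSup_of_mem ht hu)))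
        exact fun u hu => this hu
      -- Subtracting the eigenvalue of bidegree `s` kills that component, while `x` is multiplied by
      -- a nonzero scalar.
      have h1 : (((a ^ p * b ^ q : Circle) : ℂ) - ((a ^ s.1 * b ^ s.2 : Circle) : ℂ)) • x =
          scaleFib n a b z - ((a ^ s.1 * b ^ s.2 : Circle) : ℂ) • z := by
        rw [sub_smul, ← hx a b, ← hyz, map_add, scaleFib_of_mem_bideg hy, smul_add]
        abel
      have h2 : ((a ^ p * b ^ q : Circle) : ℂ) - ((a ^ s.1 * b ^ s.2 : Circle) : ℂ) ≠ 0 :=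
        sub_ne_zero.2 fun h => hab (Circle.ext h)
      have h3 := U.sub_mem (hstab z hz) (U.smul_mem ((a ^ s.1 * b ^ s.2 : Circle) : ℂ) hz)
      rw [← h1] at h3
      exact (U.smul_mem_iff h2).1 h3
  have hx' : x ∈ ⨆ s : ℤ × ℤ, bideg n s.1 s.2 := by rw [iSup_bideg]; trivial
  obtain ⟨S, hS⟩ := Submodule.exists_finset_of_mem_iSup _ hx'
  refine key (S.erase (p, q)) (Finset.notMem_erase _ _) ?_
  have hle : ⨆ s ∈ S, bideg n s.1 s.2 ≤
      bideg n p q ⊔ ⨆ s ∈ S.erase (p, q), bideg n s.1 s.2 := by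
    refine iSup₂_le fun s hs => ?_
    by_cases h : s = (p, q)
    · subst h
      exact le_sup_left
    · exact le_sup_of_le_right (le_iSup₂_of_le s (Finset.mem_erase.2 ⟨h, hs⟩) le_rfl)
  exact hle hS

end

section

section Manifold

variable {n : ℕ} {M : Type*}

variable (M) in
/-- The rescaling of sections: multiplication of `dz` (or `∂/∂z`) by `a`, of `dz̄` by `b`, and of
the section by `c`. -/
def twist (c : ℂˣ) (a b : Circle) : (M → Fib n) ≃ₗ[ℂ] (M → Fib n) :=
  LinearEquiv.piCongrRight fun _ => (twistFib n c a b).toLinearEquiv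

theorem twist_apply (c : ℂˣ) (a b : Circle) (s : M → Fib n) (x : M) :
    twist M c a b s x = twistFib n c a b (s x) := rfl

theorem twist_mul (c c' : ℂˣ) (a b : Circle) (s t : M → Fib n) :
    twist M c a b s * twist M c' a b t = twist M (c * c') a b (s * t) :=
  funext fun _ => twistFib_mul _ _ _ _ _ _

theorem twist_inv_twist (c : ℂˣ) (a b : Circle) (s : M → Fib n) :
    twist M c⁻¹ a⁻¹ b⁻¹ (twist M c a b s) = s := by
  funext x
  simp [twist_apply, twistFib_apply, scaleFib_inv]

theorem par_twist (c : ℂˣ) (a b : Circle) (s : M → Fib n) :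
    par (twist M c a b s) = twist M c a b (par s) :=
  funext fun _ => involute_twistFib _ _ _ _

/-! ## Weights of sections -/

/-- The scalar that makes `twist` trivial in bidegree `(p, q)`. -/
def invWeight (p q : ℤ) (a b : Circle) : ℂˣ := Circle.toUnits a ^ (-p) * Circle.toUnits b ^ (-q)

variable (n M) in
/-- The sections of bidegree `(p, q)`, described by their behaviour under rescaling. -/
def weightSpace (p q : ℤ) : Submodule ℂ (M → Fib n) where
  carrier := {s | ∀ a b : Circle, twist M (invWeight p q a b) a b s = s}
  add_mem' hs ht a b := by rw [map_add, hs a b, ht a b]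
  zero_mem' a b := map_zero _
  smul_mem' z s hs a b := by rw [map_smul, hs a b]

theorem mem_weightSpace_iff {p q : ℤ} {s : M → Fib n} :
    s ∈ weightSpace n M p q ↔ ∀ x, s x ∈ bideg n p q := by
  have key : ∀ (a b : Circle) (x : Fib n), twistFib n (invWeight p q a b) a b x = x ↔
      scaleFib n a b x = ((a ^ p * b ^ q : Circle) : ℂ) • x := by
    intro a b x
    have h : ((invWeight p q a b : ℂˣ) : ℂ) = (((a ^ p * b ^ q : Circle) : ℂ))⁻¹ := by
      simp [invWeight, mul_comm]
    rw [twistFib_apply, h, inv_smul_eq_iff₀ (Circle.coe_ne_zero _)]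
  constructor
  · intro h x
    exact mem_bideg_of_scaleFib fun a b => (key a b _).1 (congrFun (h a b) x)
  · intro h a b
    funext x
    exact (key a b _).2 (scaleFib_of_mem_bideg (h x) a b)

theorem par_mem_weightSpace {p q : ℤ} {s : M → Fib n} (hs : s ∈ weightSpace n M p q) :
    par s ∈ weightSpace n M p q := fun a b => by rw [← par_twist, hs a b]

theorem iterate_par_mem_weightSpace {p q : ℤ} {s : M → Fib n} (hs : s ∈ weightSpace n M p q)
    (m : ℕ) : par^[m] s ∈ weightSpace n M p q := by
  induction m with
  | zero => exact hs
  | succ m ih => rw [Function.iterate_succ_apply']; exact par_mem_weightSpace ih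

theorem parityPart_mem_weightSpace {p q : ℤ} {s : M → Fib n} (hs : s ∈ weightSpace n M p q)
    (e : Fin 2) : parityPart e s ∈ weightSpace n M p q :=
  Submodule.smul_mem _ _ (add_mem hs (Submodule.smul_mem _ _ (par_mem_weightSpace hs)))

theorem mul_mem_weightSpace {p q p' q' : ℤ} {s t : M → Fib n} (hs : s ∈ weightSpace n M p q)
    (ht : t ∈ weightSpace n M p' q') : s * t ∈ weightSpace n M (p + p') (q + q') := fun a b => by
  have h : invWeight (p + p') (q + q') a b = invWeight p q a b * invWeight p' q' a b := by
    simp only [invWeight, neg_add, zpow_add]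
    exact mul_mul_mul_comm _ _ _ _
  rw [h, ← twist_mul, hs a b, ht a b]

/-- An operator that is equivariant up to the character `a ^ i * b ^ j` lowers bidegrees by
`(i, j)`. -/
theorem map_mem_weightSpace {F : (M → Fib n) → (M → Fib n)} {i j : ℤ}
    (hF : ∀ c a b s, F (twist M c a b s) =
      twist M (c * (Circle.toUnits a ^ i * Circle.toUnits b ^ j)) a b (F s))
    {p q : ℤ} {s : M → Fib n} (hs : s ∈ weightSpace n M p q) :
    F s ∈ weightSpace n M (p - i) (q - j) := fun a b => by
  have h : invWeight (p - i) (q - j) a b =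
      invWeight p q a b * (Circle.toUnits a ^ i * Circle.toUnits b ^ j) := by
    rw [invWeight, invWeight, mul_mul_mul_comm, ← zpow_add, ← zpow_add, neg_sub, neg_sub,
      sub_eq_neg_add, sub_eq_neg_add]
  rw [h, ← hF, hs a b]

/-! ## Equivariance -/

/-- Since `L` is invertible, the derivative commutes with it even where `f` is not differentiable;
equivariance therefore holds for arbitrary sections. -/
theorem wirtBar_comp (L : Fib n ≃L[ℂ] Fib n) (i : Fin n) (f : Cn n → Fib n) (u : Cn n) :
    wirtBar i (L ∘ f) u = L (wirtBar i f u) := by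
  have h : fderiv ℝ (L ∘ f) u = ((L.restrictScalars ℝ : Fib n ≃L[ℝ] Fib n) :
      Fib n →L[ℝ] Fib n).comp (fderiv ℝ f u) :=
    (L.restrictScalars ℝ).comp_fderiv
  simp only [wirtBar, h, map_smul, map_add]
  rfl

theorem wirt_comp (L : Fib n ≃L[ℂ] Fib n) (i : Fin n) (f : Cn n → Fib n) (u : Cn n) :
    wirt i (L ∘ f) u = L (wirt i f u) := by
  have h : fderiv ℝ (L ∘ f) u = ((L.restrictScalars ℝ : Fib n ≃L[ℝ] Fib n) :
      Fib n →L[ℝ] Fib n).comp (fderiv ℝ f u) :=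
    (L.restrictScalars ℝ).comp_fderiv
  simp only [wirt, h, map_smul, map_sub]
  rfl

variable [TopologicalSpace M] [ChartedSpace (Cn n) M]

/-- Frame changes that commute with the rescaling of the fibres. -/
def CommutesWithScaling (tr : M → M → (Coef n →ₗ[ℂ] Coef n)) : Prop :=
  ∀ x y a b, tr x y ∘ₗ scaleCoef n a b = scaleCoef n a b ∘ₗ tr x y

theorem localRep_twist {tr : M → M → (Coef n →ₗ[ℂ] Coef n)} (htr : CommutesWithScaling tr)
    (c : ℂˣ) (a b : Circle) (s : M → Fib n) (x : M) :
    localRep tr (twist M c a b s) x = twistFib n c a b ∘ localRep tr s x := by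
  funext u
  set y := (extChartAt 𝓘(ℂ, Cn n) x).symm u with hy
  have h : (ExteriorAlgebra.map (tr x y)).comp (scaleFib n a b) =
      (scaleFib n a b).comp (ExteriorAlgebra.map (tr x y)) := by
    rw [scaleFib, ExteriorAlgebra.map_comp_map, ExteriorAlgebra.map_comp_map, htr]
  have h' := DFunLike.congr_fun h (s y)
  simp only [AlgHom.comp_apply] at h'
  simp only [localRep, twist_apply, twistFib_apply, Function.comp_apply, map_smul, ← hy, h']

variable [IsManifold 𝓘(ℂ, Cn n) ω M]

/-- Holomorphic changes of charts do not mix the two summands, and on each of them the rescaling is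
a scalar. -/
theorem commutesWithScaling_polyTrans : CommutesWithScaling (polyTrans (n := n) (M := M)) := by
  intro x y a b
  refine LinearMap.ext fun m => ?_
  simp only [polyTrans, LinearMap.comp_apply, scaleCoef_apply, LinearMap.prodMap_apply, map_smul]

theorem commutesWithScaling_formTrans : CommutesWithScaling (formTrans (n := n) (M := M)) := by
  intro x y a b
  refine LinearMap.ext fun m => ?_
  simp only [formTrans, LinearMap.comp_apply, scaleCoef_apply, LinearMap.prodMap_apply, map_smul]

theorem dbar_twist (c : ℂˣ) (a b : Circle) (s : M → Fib n) :
    dbar (twist M c a b s) = twist M (c * (Circle.toUnits b)⁻¹) a b (dbar s) := by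
  funext x
  simp only [dbar, dbarOp, localRep_twist commutesWithScaling_polyTrans, wirtBar_comp,
    dzbar_mul_twistFib, twist_apply, map_sum]

theorem delForm_twist (c : ℂˣ) (a b : Circle) (s : M → Fib n) :
    delForm (twist M c a b s) = twist M (c * (Circle.toUnits a)⁻¹) a b (delForm s) := by
  funext x
  simp only [delForm, localRep_twist commutesWithScaling_formTrans, wirt_comp,
    dz_mul_twistFib, twist_apply, map_sum]

theorem twist_mem_B (c : ℂˣ) (a b : Circle) (s : M → Fib n) :
    twist M c a b s ∈ B n M ↔ s ∈ B n M := by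
  refine forall_congr' fun x => ?_
  rw [localRep_twist commutesWithScaling_polyTrans]
  exact ((twistFib n c a b).restrictScalars ℝ).comp_contDiffOn_iff

theorem mem_cocycles {s : M → Fib n} : s ∈ cocycles n M ↔ s ∈ B n M ∧ dbar s = 0 := by
  simp only [cocycles, Submodule.mem_map, LinearMap.mem_ker]
  constructor
  · rintro ⟨t, ht, rfl⟩
    exact ⟨t.2, ht⟩
  · rintro ⟨h, h'⟩
    exact ⟨⟨s, h⟩, h', rfl⟩

theorem twist_mem_cocycles (c : ℂˣ) (a b : Circle) (s : M → Fib n) :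
    twist M c a b s ∈ cocycles n M ↔ s ∈ cocycles n M := by
  rw [mem_cocycles, mem_cocycles, twist_mem_B, dbar_twist, LinearEquiv.map_eq_zero_iff]

theorem twist_mem_range_dbarLin (c : ℂˣ) (a b : Circle) {s : M → Fib n}
    (hs : s ∈ LinearMap.range (dbarLin n M)) :
    twist M c a b s ∈ LinearMap.range (dbarLin n M) := by
  obtain ⟨t, rfl⟩ := hs
  refine ⟨⟨twist M (c * Circle.toUnits b) a b t.1, (twist_mem_B _ _ _ _).2 t.2⟩, ?_⟩
  change dbar (twist M _ a b t.1) = twist M c a b (dbar t.1)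
  rw [dbar_twist, mul_inv_cancel_right]

/-! ### Equivariance of the Batalin-Vilkovisky and Hodge operators -/

namespace CalabiYau

variable (X : CalabiYau n M)

theorem vol_twist (a b : Circle) (x : M) :
    twistFib n (Circle.toUnits a ^ n) a⁻¹ b (X.vol x) = X.vol x := by
  rw [twistFib_apply, scaleFib_of_mem_bideg (X.vol_mem x), smul_smul]
  convert one_smul ℂ (X.vol x)
  simp

theorem bigstar_twist (c : ℂˣ) (a b : Circle) (x : M) (s : Fib n) :
    X.bigstar x (twistFib n c a b s) =
      twistFib n (c * Circle.toUnits a ^ n) a⁻¹ b (X.bigstar x s) := by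
  rw [bigstar, bigstar, ← polyAction_twistFib, X.vol_twist]

theorem bigstarInv_twist (c : ℂˣ) (a b : Circle) (x : M) (σ : Fib n) :
    X.bigstarInv x (twistFib n (c * Circle.toUnits a ^ n) a⁻¹ b σ) =
      twistFib n c a b (X.bigstarInv x σ) := by
  refine theUnique_map (twistFib n c a b).toEquiv (map_zero (twistFib n c a b)) fun s => ?_
  change X.bigstar x (twistFib n c a b s) = _ ↔ _
  rw [bigstar_twist]
  exact (twistFib n (c * Circle.toUnits a ^ n) a⁻¹ b).injective.eq_iff

theorem bv_twist (c : ℂˣ) (a b : Circle) (s : M → Fib n) :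
    X.bv (twist M c a b s) = twist M (c * Circle.toUnits a) a b (X.bv s) := by
  funext x
  have h : (fun y => X.bigstar y (twist M c a b s y)) =
      twist M (c * Circle.toUnits a ^ n) a⁻¹ b (fun y => X.bigstar y (s y)) :=
    funext fun y => X.bigstar_twist c a b y (s y)
  -- On forms `dz` is rescaled by `a⁻¹`, so `∂` contributes the character `a`: raising the form
  -- degree lowers the polyvector degree.
  rw [bv, h, delForm_twist, twist_apply, map_inv, inv_inv, mul_right_comm, bigstarInv_twist]
  rfl

theorem formInner_twist (c c' : ℂˣ) (a b : Circle) (x : M) (σ τ : Fib n) :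
    X.formInner x (twistFib n c a b σ) (twistFib n c' a b τ) =
      c * conj (c' : ℂ) * X.formInner x σ τ := by
  simp only [formInner, Finset.mul_sum]
  refine Finset.sum_congr rfl fun I _ => Finset.sum_congr rfl fun J _ => ?_
  rw [formComp_twistFib, formComp_twistFib, map_mul, map_mul, ← Circle.coe_inv_eq_conj]
  have h := Circle.coe_ne_zero (a ^ I.card * b ^ J.card)
  rw [Circle.coe_inv]
  field_simp

theorem bv_mem_weightSpace {p q : ℤ} {s : M → Fib n} (hs : s ∈ weightSpace n M p q) :
    X.bv s ∈ weightSpace n M (p - 1) q := by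
  simpa using map_mem_weightSpace (i := 1) (j := 0)
    (fun c a b s => by simpa using X.bv_twist c a b s) hs

theorem bracket_mem_weightSpace {p q p' q' : ℤ} {s t : M → Fib n}
    (hs : s ∈ weightSpace n M p q) (ht : t ∈ weightSpace n M p' q') :
    X.bracket s t ∈ weightSpace n M (p + p' - 1) (q + q') := by
  have h1 := X.bv_mem_weightSpace (mul_mem_weightSpace hs ht)
  have h2 := mul_mem_weightSpace (X.bv_mem_weightSpace hs) ht
  have h3 := mul_mem_weightSpace (par_mem_weightSpace hs) (X.bv_mem_weightSpace ht)
  rw [show p - 1 + p' = p + p' - 1 by ring] at h2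
  rw [show p + (p' - 1) = p + p' - 1 by ring] at h3
  exact sub_mem (sub_mem h1 h2) h3

theorem binary_mem_weightSpace (d : Dec) {p q p' q' : ℤ} {s t : M → Fib n}
    (hs : s ∈ weightSpace n M p q) (ht : t ∈ weightSpace n M p' q') :
    X.binary d s t ∈
      weightSpace n M (p + p' - if d = Dec.brk then 1 else 0) (q + q') := by
  cases d
  · simpa [binary] using mul_mem_weightSpace hs ht
  · simpa [binary] using X.bracket_mem_weightSpace hs ht

variable [MeasurableSpace M]

theorem inner_twist (c c' : ℂˣ) (a b : Circle) (s t : M → Fib n) :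
    X.inner (twist M c a b s) (twist M c' a b t) = c * conj (c' : ℂ) * X.inner s t := by
  have ha : ((Circle.toUnits a ^ n : ℂˣ) : ℂ) * conj ((Circle.toUnits a ^ n : ℂˣ) : ℂ) = 1 := by
    rw [← map_pow, Circle.toUnits_apply, Units.val_mk0, ← Circle.coe_inv_eq_conj,
      ← Circle.coe_mul, mul_inv_cancel, Circle.coe_one]
  simp only [inner, twist_apply, bigstar_twist, formInner_twist]
  rw [integral_const_mul]
  congr 1
  rw [Units.val_mul, Units.val_mul, map_mul]
  linear_combination (c * conj (c' : ℂ)) * ha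

/-- The torus acts unitarily, so the adjoint has the conjugate inverse of the character `b⁻¹` of
`∂̄` after passing to the other side, namely `b`. The test sections are rescaled along with `s`. -/
theorem dbarAdj_twist (c : ℂˣ) (a b : Circle) (s : M → Fib n) :
    X.dbarAdj (twist M c a b s) = twist M (c * Circle.toUnits b) a b (X.dbarAdj s) := by
  refine theUnique_map (twist M (c * Circle.toUnits b) a b).toEquiv (map_zero (twist M _ a b))
    fun t => ?_
  change (twist M _ a b t ∈ _ ∧ ∀ r ∈ _, _ = X.inner r (twist M _ a b t)) ↔ _
  rw [twist_mem_B]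
  refine and_congr_right fun _ => ?_
  rw [(twist M 1 a b).surjective.forall]
  refine forall_congr' fun r => ?_
  rw [twist_mem_B, dbar_twist, inner_twist, inner_twist]
  refine imp_congr_right fun _ => ?_
  have hb : conj (b : ℂ) = (b : ℂ)⁻¹ := by rw [← Circle.coe_inv_eq_conj, Circle.coe_inv]
  have h : ((1 * (Circle.toUnits b)⁻¹ : ℂˣ) : ℂ) * conj (c : ℂ) =
      ((1 : ℂˣ) : ℂ) * conj ((c * Circle.toUnits b : ℂˣ) : ℂ) := by
    simp [hb, mul_comm]
  rw [h]
  refine mul_right_inj' ?_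
  simp

theorem laplacian_twist (c : ℂˣ) (a b : Circle) (s : M → Fib n) :
    X.laplacian (twist M c a b s) = twist M c a b (X.laplacian s) := by
  simp only [laplacian, dbarAdj_twist, dbar_twist, map_add, mul_inv_cancel_right,
    inv_mul_cancel_right]

theorem isHarmonic_twist (c : ℂˣ) (a b : Circle) (s : M → Fib n) :
    X.IsHarmonic (twist M c a b s) ↔ X.IsHarmonic s := by
  rw [IsHarmonic, IsHarmonic, twist_mem_cocycles, dbarAdj_twist, LinearEquiv.map_eq_zero_iff]

theorem inner_twist_one (c : ℂˣ) (a b : Circle) (s r : M → Fib n) :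
    X.inner (twist M c a b s) (twist M 1 a b r) = c * X.inner s r := by
  simp [inner_twist]

theorem harmProj_twist (c : ℂˣ) (a b : Circle) (s : M → Fib n) :
    X.harmProj (twist M c a b s) = twist M c a b (X.harmProj s) := by
  refine theUnique_map (twist M c a b).toEquiv (map_zero (twist M c a b)) fun t => ?_
  change (X.IsHarmonic (twist M c a b t) ∧ ∀ r, _ → X.inner (twist M c a b t) r = _) ↔ _
  rw [isHarmonic_twist, (twist M 1 a b).surjective.forall]
  simp only [isHarmonic_twist, inner_twist_one, mul_right_inj' c.ne_zero]

theorem green_twist (c : ℂˣ) (a b : Circle) (s : M → Fib n) :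
    X.green (twist M c a b s) = twist M c a b (X.green s) := by
  refine theUnique_map (twist M c a b).toEquiv (map_zero (twist M c a b)) fun t => ?_
  change (twist M c a b t ∈ _ ∧ (∀ r, _ → X.inner (twist M c a b t) r = 0) ∧
    X.laplacian (twist M c a b t) = _) ↔ _
  rw [twist_mem_B, (twist M 1 a b).surjective.forall, laplacian_twist, harmProj_twist, ← map_sub,
    (twist M c a b).injective.eq_iff]
  simp only [isHarmonic_twist, inner_twist_one, mul_eq_zero, c.ne_zero, false_or]

theorem htpy_twist (c : ℂˣ) (a b : Circle) (s : M → Fib n) :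
    X.htpy (twist M c a b s) = twist M (c * Circle.toUnits b) a b (X.htpy s) := by
  rw [htpy, green_twist, dbarAdj_twist, htpy]

theorem htpy_mem_weightSpace {p q : ℤ} {s : M → Fib n} (hs : s ∈ weightSpace n M p q) :
    X.htpy s ∈ weightSpace n M p (q - 1) := by
  simpa using map_mem_weightSpace (i := 0) (j := 1)
    (fun c a b s => by simpa using X.htpy_twist c a b s) hs

theorem harmProj_mem_weightSpace {p q : ℤ} {s : M → Fib n} (hs : s ∈ weightSpace n M p q) :
    X.harmProj s ∈ weightSpace n M p q := fun a b => by rw [← harmProj_twist, hs a b]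

/-- A representative `s₀` of bidegree `(p, q)` is fixed by the normalized twist, so the twist
preserves its class as well as harmonicity. The condition that singles out the harmonic
representative is thus invariant, and so is its solution. -/
theorem incl_mem_weightSpace {p q : ℤ} {z : H n M} (hz : z ∈ cohBideg (n := n) (M := M) p q) :
    X.incl z ∈ weightSpace n M p q := by
  intro a b
  obtain ⟨s₀, hs₀, rfl⟩ := hz
  have hw : s₀.1 ∈ weightSpace n M p q := mem_weightSpace_iff.2 fun x => by
    simpa using hs₀ x trivial
  have hcls : ∀ (c : ℂˣ) (a b : Circle), twist M c a b s₀.1 = s₀.1 → ∀ t ∈ cocycles n M,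
      cls t = Submodule.mkQ _ s₀ → cls (twist M c a b t) =
        (Submodule.mkQ _ s₀ : H n M) := by
    intro c a b h₀ t ht h
    rw [cls, dif_pos ht] at h
    have h' := (Submodule.Quotient.eq _).1 h
    rw [cls, dif_pos ((twist_mem_cocycles _ _ _ _).2 ht)]
    refine (Submodule.Quotient.eq _).2 ?_
    have h1 : t - s₀.1 ∈ LinearMap.range (dbarLin n M) := h'
    have h2 := twist_mem_range_dbarLin c a b h1
    rw [map_sub, h₀] at h2
    exact h2
  refine (theUnique_map (twist M (invWeight p q a b) a b).toEquiv
    (map_zero (twist M (invWeight p q a b) a b)) fun t => ?_).symm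
  change (X.IsHarmonic (twist M _ a b t) ∧ _) ↔ _
  rw [isHarmonic_twist]
  refine and_congr_right fun ht => ⟨fun h => ?_, fun h => hcls _ a b (hw a b) t ht.1 h⟩
  -- The converse implication applies the same fact to the inverse twist.
  have h1 := hcls (invWeight p q a b)⁻¹ a⁻¹ b⁻¹ ?_ _ ((twist_mem_cocycles _ a b _).2 ht.1) h
  · rwa [twist_inv_twist] at h1
  · conv_lhs => rw [← hw a b]
    rw [twist_inv_twist]

theorem proj_mem_cohBideg {p q : ℤ} {s : M → Fib n} (hs : s ∈ weightSpace n M p q) :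
    X.proj s ∈ cohBideg (n := n) (M := M) p q := by
  rw [proj, cls]
  split_ifs with h
  · exact ⟨⟨_, h⟩, fun x _ => mem_weightSpace_iff.1 (X.harmProj_mem_weightSpace hs) x, rfl⟩
  · exact zero_mem _

/-! ## Bidegrees of the transferred operations -/

/-- Every vertex is followed by one homotopy, which costs one `dz̄`-degree, and every bracket costs
one polyvector degree. -/
theorem edgeVal_mem_weightSpace {k : ℕ} {x : Fin k → M → Fib n} {p q : Fin k → ℤ}
    (hx : ∀ i, x i ∈ weightSpace n M (p i) (q i)) (T : Tree (Fin k)) (hT : T.deltas = 0) :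
    X.edgeVal x T ∈ weightSpace n M ((T.leaves.map p).sum - T.brks)
      ((T.leaves.map q).sum - (T.prods + T.brks)) := by
  induction T with
  | leaf i => simpa [Tree.leaves, Tree.brks, Tree.prods, edgeVal] using hx i
  | delta t ih => simp [Tree.deltas] at hT
  | node d l r ihl ihr =>
    simp only [Tree.deltas, Nat.add_eq_zero_iff] at hT
    have h := X.htpy_mem_weightSpace (Submodule.smul_mem _ ((-1 : ℂ) ^ (l.prods * r.prods))
      (X.binary_mem_weightSpace d (iterate_par_mem_weightSpace (ihl hT.1) r.prods) (ihr hT.2)))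
    rw [edgeVal]
    convert h using 2
    · cases d <;> simp [Tree.leaves, Tree.brks] <;> ring
    · cases d <;> simp [Tree.leaves, Tree.brks, Tree.prods] <;> ring

/-- The root vertex carries no homotopy, whence the correction `+ 1`; a single leaf has no root
vertex and is excluded. -/
theorem rootVal_mem_weightSpace {k : ℕ} {x : Fin k → M → Fib n} {p q : Fin k → ℤ}
    (hx : ∀ i, x i ∈ weightSpace n M (p i) (q i)) (T : Tree (Fin k)) (hT : T.deltas = 0)
    (hT' : 2 ≤ T.leaves.length) :
    X.rootVal x T ∈ weightSpace n M ((T.leaves.map p).sum - T.brks)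
      ((T.leaves.map q).sum - (T.prods + T.brks) + 1) := by
  cases T with
  | leaf i => simp [Tree.leaves] at hT'
  | delta t => simp [Tree.deltas] at hT
  | node d l r =>
    simp only [Tree.deltas, Nat.add_eq_zero_iff] at hT
    have h := Submodule.smul_mem _ ((-1 : ℂ) ^ (l.prods * r.prods))
      (X.binary_mem_weightSpace d
        (iterate_par_mem_weightSpace (X.edgeVal_mem_weightSpace hx l hT.1) r.prods)
        (X.edgeVal_mem_weightSpace hx r hT.2))
    rw [rootVal]
    convert h using 2
    · cases d <;> simp [Tree.leaves, Tree.brks] <;> ring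
    · cases d <;> simp [Tree.leaves, Tree.brks, Tree.prods] <;> ring

theorem treeOp_mem_cohBideg {k : ℕ} (hk : 2 ≤ k) {T : Tree (Fin k)} (hT : T.deltas = 0)
    (hp : T.leaves.Perm (List.finRange k)) {x : Fin k → H n M} {p q : Fin k → ℤ}
    (hx : ∀ i, x i ∈ cohBideg (n := n) (M := M) (p i) (q i)) :
    X.treeOp T x ∈ cohBideg (n := n) (M := M) ((∑ i, p i) + -(T.brks : ℤ))
      ((∑ i, q i) + (-(k : ℤ) + 2)) := by
  refine Submodule.sum_mem _ fun ε _ => Submodule.smul_mem _ _ (X.proj_mem_cohBideg ?_)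
  have h := X.rootVal_mem_weightSpace
    (fun i => parityPart_mem_weightSpace (X.incl_mem_weightSpace (hx i)) (ε i)) T hT
    (by rw [hp.length_eq, List.length_finRange]; exact hk)
  have hs : ∀ f : Fin k → ℤ, (T.leaves.map f).sum = ∑ i, f i := fun f => by
    rw [(hp.map f).sum_eq, Fin.sum_univ_def]
  -- There are `k - 1` vertices, so the `dz̄`-shift is `-(k - 1) + 1 = -k + 2`, whatever the
  -- decorations.
  have hcount := prods_add_brks hp
  rw [hs, hs] at h
  convert h using 2
  · ring
  · have hcount' : (T.prods : ℤ) + T.brks + 1 = k := by exact_mod_cast hcount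
    linarith

theorem hasBidegree_transferredOp {k : ℕ} (hk : 2 ≤ k) {c : BVcoDelta k 0} {ℓ : ℕ}
    (hℓ : HomogeneousBrackets c ℓ) :
    HasBidegree (X.transferredOp c) (-(ℓ : ℤ)) (-(k : ℤ) + 2) := by
  intro p q x hx
  refine Submodule.smul_mem _ _ (finsum_induction (· ∈ cohBideg _ _) (zero_mem _)
    (fun _ _ => add_mem) fun T => ?_)
  by_cases hT : c.1 T = 0
  · rw [hT, zero_smul]
    exact zero_mem _
  · have hd : T.deltas = 0 := by
      by_contra hd
      exact hT (c.2.2 T hd)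
    have h := X.treeOp_mem_cohBideg hk hd (c.2.1.labels T hT) hx
    rw [hℓ T hT] at h
    exact Submodule.smul_mem _ _ h

end CalabiYau

end Manifold

end

end

end CYHy

theorem mainTheorem6 {n : ℕ} {M : Type*} [TopologicalSpace M] [T2Space M] [CompactSpace M]
    [ChartedSpace (CYHy.Cn n) M] [IsManifold 𝓘(ℂ, CYHy.Cn n) ω M]
    [MeasurableSpace M] [BorelSpace M] (X : CYHy.CalabiYau n M)
    {k : ℕ} (hk : 2 ≤ k) (c : CYHy.BVcoDelta k 0) (ℓ : ℕ) (hℓ : CYHy.HomogeneousBrackets c ℓ)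
    (hc : (CYHy.boundaries k).mkQ c ≠ 0) :
    ((CYHy.boundaries k).mkQ c ∈ CYHy.higherOps k →
      ((0 : ℤ) ≤ ℓ ∧ (ℓ : ℤ) < (k : ℤ) - 2) ∧
        CYHy.HasBidegree (X.transferredOp c) (-(ℓ : ℤ)) (-(k : ℤ) + 2)) ∧
    ((CYHy.boundaries k).mkQ c ∉ CYHy.higherOps k →
      CYHy.HasBidegree (X.transferredOp c) (-(k : ℤ) + 2) (-(k : ℤ) + 2)) := by
  refine ⟨fun h => ⟨⟨Int.natCast_nonneg ℓ, CYHy.brackets_lt_of_mem_higherOps hk hℓ hc h⟩,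
    X.hasBidegree_transferredOp hk hℓ⟩, fun h => ?_⟩
  have hb := X.hasBidegree_transferredOp hk hℓ
  rwa [CYHy.brackets_eq_of_notMem_higherOps hℓ h, neg_sub, sub_eq_neg_add] at hb
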